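/- **Setting.** Let $n$ cameras $\mathcal V=\{1,\dots,n\}$ have poses $g_{wi}(t)=(p_{wi}(t),R_{wi}(t))\in SE(3)=\mathbb R^3\times SO(3)$, $t\ge 0$, relative to a world frame, with body velocities $V^b_{wi}$, i.e. $\dot g_{wi}=g_{wi}\hat V^b_{wi}$. Here $g=(p,R)$ is identified with the homogeneous matrix $\begin{bmatrix}R&p\\0&1\end{bmatrix}$, and for $V=(v,\omega)\in\mathbb R^3\times\mathbb R^3$, $\hat V=\begin{bmatrix}\hat\omega&v\\0&0\end{bmatrix}$, where $\hat\omega b=\omega\times b$. Let $\mathcal V_f\subseteq\mathcal V$ be the time-invariant set of cameras viewing the target. For $i\in\mathcal V_f$ let $g_{wo_i}=(p_{wo_i},R_{wo_i})\in SE(3)$ be the constant (static target) pose consistent with the measurement of camera $i$. Put $g_{io_i}=(p_{io_i},R_{io_i})=g_{wi}^{-1}g_{wo_i}$ and $g_{ij}=g_{wi}^{-1}g_{wj}$. Let $$\phi(R)=\tfrac12\|I_3-R\|_F^2,\qquad \psi(g)=\tfrac12\|I_4-g\|_F^2,$$ let $g^*=(p^*,R^*)$ be a minimizer over $g\in SE(3)$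 of $\sum_{j\in\mathcal V_f}\psi(g^{-1}g_{wo_j})$, and let $g_i^*=(p_i^*,R_i^*)=g_{wi}^{-1}g^*$. For a rotation $R$ write $R>0$ if $x^TRx>0$ for all $x\neq0$. **Observer.** Camera $i$ has an estimate $\bar g_i(t)=(\bar p_i(t),\bar R_i(t))\in SE(3)$. With $E_R(p,R)=\big(p,\ (\tfrac12(R-R^T))^\vee\big)$, where $\vee$ is the inverse of $\wedge$, with $\mathcal N_i$ the set of neighbors of $i$ in the communication graph, and with gains $k_e,k_s>0$, the estimates satisfy for $t\ge0$ $$\dot{\bar g}_i=-\hat V^b_{wi}\bar g_i+\bar g_i\hat u_{ei},\qquad u_{ei}=\delta_i k_e E_R(\bar g_i^{-1}g_{io_i})+k_s\sum_{j\in\mathcal N_i}E_R(\bar g_i^{-1}g_{ij}\bar g_j),$$ where $\delta_i=1$ if $i\in\mathcal V_f$, and $\delta_i=0$ (no visual feedback term) otherwise. **Assumptions.** The communication graph is fixed, undirected and connected. Moreover $|\mathcal V_f|\ge2$, there are $i,j\in\mathcal V_f$ with $p_{wo_i}\ne p_{wo_j}$ and $R_{wo_i}\ne R_{wo_j}$,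 and $R_i^{*T}R_{io_i}>0$ for all $i\in\mathcal V_f$. Let $\zeta>\phi_m:=\max_{i\in\mathcal V_f}\phi(R_i^{*T}R_{io_i})$ be such that $\beta:=1-\sqrt{2\zeta}>0$. Let $\mathcal S$ be the set of orientation estimates $(\bar R_i)_{i\in\mathcal V}$ with $\bar R_i^TR_i^*>0$ for all $i\in\mathcal V$. **Averaging performance.** Let $\rho_p=\sum_{i\in\mathcal V_f}\|p_{io_i}-p_i^*\|^2$ and $\rho_R=\sum_{i\in\mathcal V_f}\phi(R_i^{*T}R_{io_i})$ (both are constant in time). The position estimates, respectively the orientation estimates, achieve $\varepsilon$-level averaging performance if there is a finite $T\ge 0$ such that for all $t\ge T$ $$\frac1n\sum_{i\in\mathcal V}\|\bar p_i(t)-p_i^*(t)\|^2<\frac{\varepsilon}{|\mathcal V_f|}\rho_p,\qquad\text{respectively}\qquad \frac1n\sum_{i\in\mathcal V}\phi\big(R_i^{*}(t)^T\bar R_i(t)\big)<\frac{\varepsilon}{|\mathcal V_f|}\rho_R .$$ **Theorem.** For every $\varepsilon\in(0,1)$ there is $\bar k>0$ such that for all gains $k_e,k_s>0$ with $k_e/k_s<\bar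 k$ and all estimates updated by the observer with $(\bar R_i(0))_{i\in\mathcal V}\in\mathcal S$, the position estimates achieve $\varepsilon$-level averaging performance and the orientation estimates achieve $\varepsilon_R$-level averaging performance, with $\varepsilon_R=1-(1-\varepsilon)\beta$. -/

import Mathlib

open scoped Matrix

noncomputable section

/-! ### Rigid motions of three-dimensional space -/

/-- The rotation group `SO(3)` of real orthogonal matrices of determinant one. -/
abbrev SO3 : Type := Matrix.specialOrthogonalGroup (Fin 3) ℝ

/-- A pose `g = (p, R)`, an element of `SE(3) = ℝ³ × SO(3)`. -/
@[ext] structure SE3 where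
  /-- the position -/
  pos : EuclideanSpace ℝ (Fin 3)
  /-- the orientation -/
  rot : SO3

/-- Body velocities `V = (v, ω)`, with linear part `v` and angular part `ω`. -/
abbrev Twist : Type := (Fin 3 → ℝ) × (Fin 3 → ℝ)

/-- The action of a rotation on a vector. -/
def SO3.act (R : SO3) (x : EuclideanSpace ℝ (Fin 3)) : EuclideanSpace ℝ (Fin 3) :=
  WithLp.toLp 2 ((R : Matrix (Fin 3) (Fin 3) ℝ) *ᵥ x.ofLp)

namespace SE3

/-- Composition `(p, R)(q, S) = (p + R q, R S)`. -/
instance : Mul SE3 := ⟨fun g h => ⟨g.pos + SO3.act g.rot h.pos, g.rot * h.rot⟩⟩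

instance : One SE3 := ⟨⟨0, 1⟩⟩

/-- Inverse `(p, R)⁻¹ = (-R⁻¹ p, R⁻¹)`; recall that `R⁻¹ = Rᵀ` in `SO(3)`. -/
instance : Inv SE3 := ⟨fun g => ⟨-SO3.act g.rot⁻¹ g.pos, g.rot⁻¹⟩⟩

/-- The homogeneous representation: the 4 by 4 block matrix with rows `R p` and `0 1`. -/
def toMatrix (g : SE3) : Matrix (Fin 3 ⊕ Unit) (Fin 3 ⊕ Unit) ℝ :=
  Matrix.fromBlocks (g.rot : Matrix (Fin 3) (Fin 3) ℝ)
    (Matrix.replicateCol Unit g.pos.ofLp) 0 1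

theorem toMatrix_mul (g h : SE3) : (g * h).toMatrix = g.toMatrix * h.toMatrix := by
  change Matrix.fromBlocks ((g.rot * h.rot : SO3) : Matrix (Fin 3) (Fin 3) ℝ)
    (Matrix.replicateCol Unit (g.pos + SO3.act g.rot h.pos).ofLp) 0 1 = _
  simp only [toMatrix, Matrix.fromBlocks_multiply]
  congr 1
  · simp
  · ext i j
    simp [SO3.act, Matrix.mul_apply, Matrix.mulVec, dotProduct, add_comm]
  · simp
  · simp

theorem toMatrix_one : (1 : SE3).toMatrix = 1 := by
  change Matrix.fromBlocks ((1 : SO3) : Matrix (Fin 3) (Fin 3) ℝ)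
    (Matrix.replicateCol Unit (0 : EuclideanSpace ℝ (Fin 3)).ofLp) 0 1 = _
  rw [← Matrix.fromBlocks_one]
  congr 1

theorem toMatrix_injective : Function.Injective toMatrix := by
  intro g h hgh
  obtain ⟨h1, h2, -, -⟩ := Matrix.fromBlocks_inj.1 hgh
  ext i
  · exact congrFun (congrFun h2 i) ()
  · exact congrFun (congrFun h1 _) _

instance : Group SE3 where
  mul_assoc a b c := toMatrix_injective (by simp only [toMatrix_mul, Matrix.mul_assoc])
  one_mul a := toMatrix_injective (by simp only [toMatrix_mul, toMatrix_one, one_mul])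
  mul_one a := toMatrix_injective (by simp only [toMatrix_mul, toMatrix_one, mul_one])
  inv_mul_cancel a := by
    refine SE3.ext ?_ (inv_mul_cancel a.rot)
    exact neg_add_cancel (SO3.act a.rot⁻¹ a.pos)

end SE3

/-- The skew-symmetric matrix `â`, with `â b = a × b`. -/
def hat (a : Fin 3 → ℝ) : Matrix (Fin 3) (Fin 3) ℝ :=
  !![0, -a 2, a 1; a 2, 0, -a 0; -a 1, a 0, 0]

theorem hat_mulVec (a b : Fin 3 → ℝ) : hat a *ᵥ b = crossProduct a b := by
  ext i
  fin_cases i <;> simp [hat, Matrix.mulVec, dotProduct, Fin.sum_univ_three, cross_apply] <;> ring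

/-- The inverse of `hat` on skew-symmetric matrices. -/
def vee (M : Matrix (Fin 3) (Fin 3) ℝ) : Fin 3 → ℝ := ![M 2 1, M 0 2, M 1 0]

theorem vee_hat (a : Fin 3 → ℝ) : vee (hat a) = a := by
  ext i
  fin_cases i <;> simp [hat, vee]

/-- The homogeneous representation of a body velocity: the 4 by 4 block matrix with rows
`ω̂ v` and `0 0`. -/
def Twist.wedge (V : Twist) : Matrix (Fin 3 ⊕ Unit) (Fin 3 ⊕ Unit) ℝ :=
  Matrix.fromBlocks (hat V.2) (Matrix.replicateCol Unit V.1) 0 0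

/-- `sk(R) = (R - R⁻¹) / 2`. -/
def skewPart (R : SO3) : Matrix (Fin 3) (Fin 3) ℝ :=
  (1 / 2 : ℝ) • ((R : Matrix (Fin 3) (Fin 3) ℝ) - ((R⁻¹ : SO3) : Matrix (Fin 3) (Fin 3) ℝ))

/-- The vector representation `E_R(g) = (p, sk(R)^∨)` of a pose error `g = (p, R)`. -/
def errorVec (g : SE3) : Twist := (g.pos.ofLp, vee (skewPart g.rot))

/-- A rotation is positive, `R > 0`, if `xᵀ R x > 0` for all `x ≠ 0` (it need not be symmetric). -/
def SO3.IsPos (R : SO3) : Prop :=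
  ∀ x : Fin 3 → ℝ, x ≠ 0 → 0 < x ⬝ᵥ ((R : Matrix (Fin 3) (Fin 3) ℝ) *ᵥ x)

section Frobenius

open scoped Matrix.Norms.Frobenius

/-- `φ(R) = ½ ‖I₃ - R‖_F²`, with the Frobenius norm. -/
def phi (R : SO3) : ℝ := (1 / 2) * ‖(1 : Matrix (Fin 3) (Fin 3) ℝ) - R‖ ^ 2

/-- `ψ(g) = ½ ‖I₄ - g‖_F²`, with the Frobenius norm. -/
def psi (g : SE3) : ℝ :=
  (1 / 2) * ‖(1 : Matrix (Fin 3 ⊕ Unit) (Fin 3 ⊕ Unit) ℝ) - g.toMatrix‖ ^ 2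

end Frobenius

/-! ### Visual sensor networks observing a static target -/

/-- A network of `n` (possibly moving) cameras looking at a static target.  Poses are relative to
the world frame, and the time is `t ≥ 0`. -/
structure VisualNetwork (n : ℕ) where
  /-- the fixed, undirected communication graph -/
  graph : SimpleGraph (Fin n)
  /-- the set of cameras which view the target -/
  viewers : Finset (Fin n)
  /-- the pose of camera `i` at time `t` -/
  camPose : Fin n → ℝ → SE3
  /-- the body velocity of camera `i` at time `t` -/
  camVel : Fin n → ℝ → Twist
  /-- the rigid body motion of the cameras, `ġ = g V̂` -/
  camMotion : ∀ i, ∀ t, 0 ≤ t → HasDerivWithinAt (fun s => (camPose i s).toMatrix)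
    ((camPose i t).toMatrix * (camVel i t).wedge) (Set.Ici 0) t
  /-- the constant pose of the (fictitious) target which is consistent with the measurement of
  camera `i`; only the values at `i ∈ viewers` are ever used -/
  target : Fin n → SE3

namespace VisualNetwork

variable {n : ℕ}

/-- The pose relative to camera `i` at time `t` of the frame whose world pose is `g`. -/
def rel (N : VisualNetwork n) (t : ℝ) (i : Fin n) (g : SE3) : SE3 := (N.camPose i t)⁻¹ * g

/-- `g` is an average of the target poses: a minimizer over `SE(3)` of the sum of
`ψ(g⁻¹ target_j)` over the cameras `j` which view the target. -/
def IsAverage (N : VisualNetwork n) (g : SE3) : Prop :=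
  ∀ h : SE3, ∑ j ∈ N.viewers, psi (g⁻¹ * N.target j) ≤ ∑ j ∈ N.viewers, psi (h⁻¹ * N.target j)

/-- The orientation error `R_i⁎⁻¹ R_{io_i}` between the average `gs` and the target of camera `i`,
both relative to camera `i` at time `t`. -/
def targetRotError (N : VisualNetwork n) (gs : SE3) (t : ℝ) (i : Fin n) : SO3 :=
  (N.rel t i gs).rot⁻¹ * (N.rel t i (N.target i)).rot

/-- The standing assumption on the targets: at least two cameras view the target, two of them
differ both in the position and in the orientation of their targets, and all target orientation
errors are positive. -/
structure TargetAssumption (N : VisualNetwork n) (gs : SE3) : Prop where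
  two_le_card : 2 ≤ N.viewers.card
  exists_ne : ∃ i ∈ N.viewers, ∃ j ∈ N.viewers,
    (N.target i).pos ≠ (N.target j).pos ∧ (N.target i).rot ≠ (N.target j).rot
  pos : ∀ t, 0 ≤ t → ∀ i ∈ N.viewers, (N.targetRotError gs t i).IsPos

/-- `ρ_p`, at time `t` (it does not depend on `t`). -/
def rhoPos (N : VisualNetwork n) (gs : SE3) (t : ℝ) : ℝ :=
  ∑ i ∈ N.viewers, ‖(N.rel t i (N.target i)).pos - (N.rel t i gs).pos‖ ^ 2

/-- `ρ_R`, at time `t` (it does not depend on `t`). -/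
def rhoRot (N : VisualNetwork n) (gs : SE3) (t : ℝ) : ℝ :=
  ∑ i ∈ N.viewers, phi (N.targetRotError gs t i)

/-- `φ_m`, the maximum of `φ` of the target orientation errors over the cameras which view the
target (a nonempty set), at time `t` (it does not depend on `t`). -/
def phiMax (N : VisualNetwork n) (gs : SE3) (t : ℝ) : ℝ :=
  ⨆ i : N.viewers, phi (N.targetRotError gs t i)

/-! #### The networked visual motion observer -/

open Classical in
/-- The input of camera `i` at time `t`, for the current estimates `gbar j` (relative to the
cameras `j`): visual feedback if `i` views the target, and mutual feedback from the neighbors. -/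
def observerInput (N : VisualNetwork n) (ke ks : ℝ) (t : ℝ) (gbar : Fin n → SE3) (i : Fin n) :
    Twist :=
  (if i ∈ N.viewers then ke • errorVec ((gbar i)⁻¹ * N.rel t i (N.target i)) else 0) +
    ks • ∑ j ∈ Finset.univ.filter (fun j => N.graph.Adj j i),
      errorVec ((gbar i)⁻¹ * (N.rel t i (N.camPose j t) * gbar j))

/-- The estimates are updated by the observer with gains `ke`, `ks`. -/
def IsObserverTrajectory (N : VisualNetwork n) (ke ks : ℝ) (gbar : ℝ → Fin n → SE3) : Prop :=
  ∀ i, ∀ t, 0 ≤ t → HasDerivWithinAt (fun s => (gbar s i).toMatrix)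
    (-(N.camVel i t).wedge * (gbar t i).toMatrix +
      (gbar t i).toMatrix * (N.observerInput ke ks t (gbar t) i).wedge) (Set.Ici 0) t

/-- The set `𝒮` of orientation estimates `R̄` with `R̄_i⁻¹ R_i⁎ > 0` for all `i`, at time `t`. -/
def admissible (N : VisualNetwork n) (gs : SE3) (t : ℝ) : Set (Fin n → SO3) :=
  {R | ∀ i, ((R i)⁻¹ * (N.rel t i gs).rot).IsPos}

/-! #### Averaging performance -/

/-- The set `Ω_p(ε)` of position estimates, at time `t`. -/
def omegaPos (N : VisualNetwork n) (gs : SE3) (ε t : ℝ) :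
    Set (Fin n → EuclideanSpace ℝ (Fin 3)) :=
  {p | 1 / (n : ℝ) * ∑ i, ‖p i - (N.rel t i gs).pos‖ ^ 2 <
    ε * (1 / (N.viewers.card : ℝ) * N.rhoPos gs t)}

/-- The set `Ω_R(ε)` of orientation estimates, at time `t`. -/
def omegaRot (N : VisualNetwork n) (gs : SE3) (ε t : ℝ) : Set (Fin n → SO3) :=
  {R | 1 / (n : ℝ) * ∑ i, phi ((N.rel t i gs).rot⁻¹ * R i) <
    ε * (1 / (N.viewers.card : ℝ) * N.rhoRot gs t)}

/-- The position estimates achieve `ε`-level averaging performance. -/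
def PosAveraging (N : VisualNetwork n) (gs : SE3) (gbar : ℝ → Fin n → SE3) (ε : ℝ) : Prop :=
  ∃ T : ℝ, 0 ≤ T ∧ ∀ t, T ≤ t → (fun i => (gbar t i).pos) ∈ N.omegaPos gs ε t

/-- The orientation estimates achieve `ε`-level averaging performance. -/
def RotAveraging (N : VisualNetwork n) (gs : SE3) (gbar : ℝ → Fin n → SE3) (ε : ℝ) : Prop :=
  ∃ T : ℝ, 0 ≤ T ∧ ∀ t, T ≤ t → (fun i => (gbar t i).rot) ∈ N.omegaRot gs ε t

end VisualNetwork

end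

/-!
Carrying the estimates over to the world frame, and then to the frame of the average `gs`, removes
the motion of the cameras: the centred estimates `Y i` satisfy `Ẏ i = Y i û i`, where the input
`u i` pulls `Y i` towards its (constant) target, with gain `ke`, and towards its neighbours, with
gain `ks`.  Optimality of the average makes the centred target positions sum to zero and the centred
target rotations sum to a symmetric matrix.  Positions and orientations decouple.

Both errors are estimated by the same principle (`exists_gain_forall_eventually_lt`): the mutual
feedback dissipates the disagreement between neighbours, which on a connected graph controls all
disagreements (`exists_le_mul_edgeSum`); up to the disagreement, the estimates sit at a common pose,
on which the visual feedback of all viewers together acts as a strict pull towards the average.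
If `ke / ks` is small, the disagreement is slaved to the slow motion of the common pose, and the
limiting squared error is at most of order `ke / ks`.  Hence both errors become arbitrarily small, and the averaging
levels `ε` and `1 - (1 - ε) β` only matter through being positive.

For positions this is the usual linear consensus estimate (`exists_gain_sum_norm_sq_lt`).  For
orientations, `φ(S)` decreases under the attraction of `R` at half the rate
`SO3.pull S R = tr R - tr (S⁻² R)`.  In unit quaternions the pull is an explicit product
(`SO3.IsQuat.pull_eq`), from which its sign, lower bounds and dissipativity follow near the identity
(`SO3.pull_nonneg`, `SO3.pull_ge`, `SO3.phi_inv_mul_le_pull_add_pull`, `SO3.sum_pull_ge`).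
The dissipation estimate needs the estimates to stay away from angle `π / 2`, uniformly in the
initial data, since the threshold for `ke / ks` comes first.  This is achieved by
`eventually_phi_le_one`, valid for all gains: the largest error does not increase while it exceeds
the errors of the targets, and as long as the level is above `1`, the viewers sink below it by an
amount which propagates through the graph, so that the level is lowered by a fixed amount in each
fixed period of time.
-/

/-! ### Differential inequalities -/

open Set Filter Topology in
/-- A maximum principle: if, above the level `M`, each `f i` has nonpositive derivative whenever it
attains the maximum of the family, then the maximum stays below `M`.  This sign condition is only
needed below a level `M₁ > M`. -/
theorem forall_le_of_deriv_nonpos_of_max {ι : Type*} [Finite ι] {f f' : ι → ℝ → ℝ} {M M₁ : ℝ}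
    (hM : M < M₁)
    (hd : ∀ i, ∀ t, 0 ≤ t → HasDerivWithinAt (f i) (f' i t) (Ici 0) t)
    (hmax : ∀ i, ∀ t, 0 ≤ t → (∀ j, f j t ≤ f i t) → M ≤ f i t → f i t < M₁ → f' i t ≤ 0)
    (h0 : ∀ i, f i 0 ≤ M) : ∀ t, 0 ≤ t → ∀ i, f i t ≤ M := by
  -- the barrier `M + η t` has positive slope, so that the maximum cannot cross it
  have key : ∀ T, 0 ≤ T → ∀ η, 0 < η → M + η * T < M₁ → ∀ i, f i T ≤ M + η * T := by
    intro T hT η hη hηT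
    have hcont : ∀ i, ContinuousOn (f i) (Icc 0 T) := fun i t ht =>
      ((hd i t ht.1).continuousWithinAt).mono Icc_subset_Ici_self
    have hsub : Icc 0 T ⊆ {t | ∀ i, f i t ≤ M + η * t} := by
      apply IsClosed.Icc_subset_of_forall_exists_gt
      · have : {t | ∀ i, f i t ≤ M + η * t} ∩ Icc 0 T
            = Icc 0 T ∩ ⋂ i, {t | t ∈ Icc 0 T ∧ f i t ≤ M + η * t} := by
          ext t
          simp only [mem_inter_iff, mem_ofPred_eq, mem_iInter]
          exact ⟨fun h => ⟨h.2, fun i => ⟨h.2, h.1 i⟩⟩, fun h => ⟨fun i => (h.2 i).2, h.1⟩⟩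
        rw [this]
        refine isClosed_Icc.inter (isClosed_iInter fun i => ?_)
        exact isClosed_Icc.isClosed_le (hcont i) (by fun_prop)
      · intro i
        simpa using h0 i
      · rintro t ⟨hft, ht0, htT⟩ y hy
        have hev : ∀ i, ∀ᶠ z in 𝓝[>] t, f i z ≤ M + η * z := by
          intro i
          have hdi : HasDerivWithinAt (f i) (f' i t) (Ici t) t :=
            (hd i t ht0).mono (Ici_subset_Ici.2 ht0)
          rcases (hft i).lt_or_eq with hlt | heq
          · have h1 : Tendsto (fun z => M + η * z - f i z) (𝓝[>] t) (𝓝 (M + η * t - f i t)) := by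
              refine Tendsto.sub ?_ (hdi.Ioi_of_Ici.continuousWithinAt)
              exact (Continuous.tendsto (by fun_prop) t).mono_left nhdsWithin_le_nhds
            filter_upwards [h1.eventually (lt_mem_nhds (sub_pos.2 hlt))] with z hz
            linarith
          · have hle : f' i t ≤ 0 := by
              have hηt : η * t ≤ η * T := by gcongr
              refine hmax i t ht0 (fun j => heq ▸ hft j) ?_ ?_
              · rw [heq]; nlinarith
              · rw [heq]; linarith
            filter_upwards [hdi.Ioi_of_Ici.limsup_slope_le' (lt_irrefl t) (hle.trans_lt hη),
              self_mem_nhdsWithin] with z hz hzt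
            rw [slope_def_field, div_lt_iff₀ (sub_pos.2 hzt)] at hz
            linarith
        obtain ⟨z, hz, hzI⟩ := ((eventually_all.2 hev).and (Ioc_mem_nhdsGT hy)).exists
        exact ⟨z, hz, hzI⟩
    exact hsub ⟨hT, le_rfl⟩
  intro t ht i
  refine le_of_forall_pos_le_add fun e he => ?_
  set e' := min e ((M₁ - M) / 2) with he'
  have he'pos : 0 < e' := lt_min he (by linarith)
  have h1 : e' / (t + 1) * t ≤ e' := by
    rw [div_mul_eq_mul_div, div_le_iff₀ (by linarith)]
    nlinarith
  have h2 := key t ht (e' / (t + 1)) (by positivity)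
    (by have := min_le_right e ((M₁ - M) / 2); linarith) i
  have := min_le_left e ((M₁ - M) / 2)
  linarith

open Set in
/-- Grönwall's inequality for a linear differential inequality with decay rate `A`. -/
theorem le_exp_of_deriv_le {f f' : ℝ → ℝ} {A B t₀ : ℝ} (hA : 0 < A) (ht₀ : 0 ≤ t₀)
    (hd : ∀ t, t₀ ≤ t → HasDerivWithinAt f (f' t) (Ici 0) t)
    (hb : ∀ t, t₀ ≤ t → f' t ≤ -A * f t + B) {t : ℝ} (ht : t₀ ≤ t) :
    f t ≤ f t₀ * Real.exp (-A * (t - t₀)) + B / A * (1 - Real.exp (-A * (t - t₀))) := by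
  have h := le_gronwallBound_of_liminf_deriv_right_le (f := f) (f' := f') (δ := f t₀) (K := -A)
    (ε := B) (a := t₀) (b := t)
    (fun s hs => ((hd s hs.1).continuousWithinAt).mono fun r hr => ht₀.trans hr.1)
    (fun s hs r hr => by
      have := ((hd s hs.1).mono (Ici_subset_Ici.2 (ht₀.trans hs.1))).liminf_right_slope_le hr
      simpa [slope_def_field, div_eq_inv_mul] using this)
    le_rfl (fun s hs => hb s hs.1) t ⟨ht, le_rfl⟩
  rw [gronwallBound_of_K_ne_0 (by linarith)] at h
  refine h.trans (le_of_eq ?_)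
  field_simp
  ring

open Filter Topology in
theorem eventually_lt_of_deriv_le {f f' : ℝ → ℝ} {A B t₀ c : ℝ} (hA : 0 < A) (ht₀ : 0 ≤ t₀)
    (hd : ∀ t, t₀ ≤ t → HasDerivWithinAt f (f' t) (Set.Ici 0) t)
    (hb : ∀ t, t₀ ≤ t → f' t ≤ -A * f t + B) (hc : B / A < c) :
    ∃ T, 0 ≤ T ∧ ∀ t, T ≤ t → f t < c := by
  have h0 : Tendsto (fun t : ℝ => Real.exp (-A * (t - t₀))) atTop (𝓝 0) := by
    refine Real.tendsto_exp_atBot.comp ?_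
    refine Tendsto.const_mul_atTop_of_neg (by linarith) ?_
    exact tendsto_atTop_add_const_right _ _ tendsto_id
  have h1 : Tendsto (fun t : ℝ => f t₀ * Real.exp (-A * (t - t₀)) +
      B / A * (1 - Real.exp (-A * (t - t₀)))) atTop (𝓝 (f t₀ * 0 + B / A * (1 - 0))) :=
    (h0.const_mul _).add ((tendsto_const_nhds.sub h0).const_mul _)
  have hlim : f t₀ * 0 + B / A * (1 - 0) < c := by simpa using hc
  obtain ⟨T, hT⟩ := eventually_atTop.1 (h1.eventually (gt_mem_nhds hlim))
  refine ⟨max T t₀, ht₀.trans (le_max_right _ _), fun t ht => ?_⟩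
  exact (le_exp_of_deriv_le hA ht₀ hd hb ((le_max_right _ _).trans ht)).trans_lt
    (hT t ((le_max_left _ _).trans ht))

/-! ### Weights on the edges of a connected graph -/

section Graph

variable {V : Type*} [Fintype V]

open Classical in
/-- The sum of the weights `w i j` over all ordered pairs `(i, j)` of adjacent vertices. -/
noncomputable def edgeSum (G : SimpleGraph V) (w : V → V → ℝ) : ℝ :=
  ∑ i, ∑ j ∈ Finset.univ.filter (fun j => G.Adj j i), w i j

theorem le_edgeSum {G : SimpleGraph V} {w : V → V → ℝ} (hw : ∀ i j, 0 ≤ w i j) {i j : V}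
    (h : G.Adj j i) : w i j ≤ edgeSum G w := by
  classical
  calc w i j ≤ ∑ j ∈ Finset.univ.filter (fun j => G.Adj j i), w i j :=
        Finset.single_le_sum (f := fun j => w i j) (fun k _ => hw i k) (by simpa using h)
    _ ≤ _ := Finset.single_le_sum
        (f := fun i => ∑ j ∈ Finset.univ.filter (fun j => G.Adj j i), w i j)
        (fun k _ => Finset.sum_nonneg fun l _ => hw k l) (Finset.mem_univ i)

theorem edgeSum_nonneg {G : SimpleGraph V} {w : V → V → ℝ} (hw : ∀ i j, 0 ≤ w i j) :
    0 ≤ edgeSum G w :=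
  Finset.sum_nonneg fun i _ => Finset.sum_nonneg fun j _ => hw i j

theorem edgeSum_swap (G : SimpleGraph V) (w : V → V → ℝ) :
    edgeSum G (fun i j => w j i) = edgeSum G w := by
  classical
  simp only [edgeSum, Finset.sum_filter]
  rw [Finset.sum_comm]
  simp only [G.adj_comm]

theorem edgeSum_add (G : SimpleGraph V) (w w' : V → V → ℝ) :
    edgeSum G (fun i j => w i j + w' i j) = edgeSum G w + edgeSum G w' := by
  simp only [edgeSum, Finset.sum_add_distrib]

theorem edgeSum_mono {G : SimpleGraph V} {w w' : V → V → ℝ} (h : ∀ i j, w i j ≤ w' i j) :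
    edgeSum G w ≤ edgeSum G w' :=
  Finset.sum_le_sum fun i _ => Finset.sum_le_sum fun j _ => h i j

/-- A discrete Poincaré inequality: on a connected graph, a squared distance (which satisfies the
triangle inequality up to the factor `2`) between any two vertices is controlled by its sum over
the edges, with a constant which depends on the graph only. -/
theorem exists_le_mul_edgeSum {G : SimpleGraph V} (hG : G.Connected) :
    ∃ C : ℝ, 0 < C ∧ ∀ w : V → V → ℝ, (∀ i j, 0 ≤ w i j) → (∀ i, w i i = 0) →
      (∀ i j k, w i k ≤ 2 * (w i j + w j k)) → ∀ i k, w i k ≤ C * edgeSum G w := by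
  classical
  have key : ∀ i k, ∃ C : ℝ, 0 ≤ C ∧ ∀ w : V → V → ℝ, (∀ i j, 0 ≤ w i j) → (∀ i, w i i = 0) →
      (∀ i j k, w i k ≤ 2 * (w i j + w j k)) → w i k ≤ C * edgeSum G w := by
    intro i k
    obtain ⟨p⟩ := hG.preconnected i k
    induction p with
    | nil => exact ⟨0, le_rfl, fun w _ h0 _ => by simp [h0]⟩
    | cons h p ih =>
      obtain ⟨C, hC, hw⟩ := ih
      refine ⟨2 * (1 + C), by positivity, fun w h1 h2 h3 => ?_⟩
      rename_i u v k
      have := h3 u v k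
      have := hw w h1 h2 h3
      have := le_edgeSum h1 h.symm
      linarith
  choose C hC hw using key
  refine ⟨1 + ∑ i, ∑ k, C i k, ?_, fun w h1 h2 h3 i k => ?_⟩
  · have : 0 ≤ ∑ i, ∑ k, C i k := Finset.sum_nonneg fun i _ => Finset.sum_nonneg fun k _ => hC i k
    linarith
  · refine (hw i k w h1 h2 h3).trans ?_
    have : C i k ≤ ∑ i, ∑ k, C i k :=
      (Finset.single_le_sum (f := fun k => C i k) (fun k _ => hC i k) (Finset.mem_univ k)).trans
        (Finset.single_le_sum (f := fun i => ∑ k, C i k)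
          (fun i _ => Finset.sum_nonneg fun k _ => hC i k) (Finset.mem_univ i))
    have := edgeSum_nonneg (G := G) h1
    gcongr
    linarith

/-- The separation of time scales.  Here `W i` is the squared error at the vertex `i`, and `d t i j`
is the squared distance between the estimates at `i` and `j`.  Suppose that the total error
dissipates at rate `ks` through the disagreement along the edges, while the visual feedback, at rate
`ke`, decreases the error of a reference vertex `v₀` up to terms which are of first order in the
distances to `v₀`.  Then the total error is eventually as small as desired, provided that `ke / ks`
is small: the disagreement absorbs the first order terms up to an error of order `ke² / ks`, which
is of higher order than the decay rate `ke`. -/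
theorem exists_gain_forall_eventually_lt {G : SimpleGraph V} (hG : G.Connected) (v₀ : V)
    {a L b target : ℝ} (ha : 0 < a) (hL : 0 < L) (hb : 0 < b) (htarget : 0 < target) :
    ∃ kbar : ℝ, 0 < kbar ∧ ∀ ke ks : ℝ, 0 < ke → 0 < ks → ke / ks < kbar →
      ∀ (W : V → ℝ → ℝ) (d : ℝ → V → V → ℝ) (U' : ℝ → ℝ) (t₀ : ℝ), 0 ≤ t₀ →
        (∀ t, t₀ ≤ t → HasDerivWithinAt (fun s => ∑ i, W i s) (U' t) (Set.Ici 0) t) →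
        (∀ t i j, 0 ≤ d t i j) → (∀ t i, d t i i = 0) →
        (∀ t i j k, d t i k ≤ 2 * (d t i j + d t j k)) →
        (∀ t i, W i t ≤ 2 * (W v₀ t + d t i v₀)) →
        (∀ t, 0 ≤ W v₀ t) →
        (∀ t, t₀ ≤ t → U' t ≤ -(ke * (a * W v₀ t -
          L * ∑ i, (√(d t i v₀) + d t i v₀)) + ks * (b * edgeSum G (d t)))) →
        ∃ T, 0 ≤ T ∧ ∀ t, T ≤ t → ∑ i, W i t < target := by
  classical
  obtain ⟨C, hC, hpath⟩ := exists_le_mul_edgeSum hG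
  set n : ℝ := (Fintype.card V : ℝ) with hn
  have hnpos : 0 < n := by
    have : 0 < Fintype.card V := Fintype.card_pos_iff.2 ⟨v₀⟩
    rw [hn]
    exact_mod_cast this
  set μ := b / C with hμ
  have hμpos : 0 < μ := by positivity
  set K := L ^ 2 * n ^ 2 / μ with hK
  have hKpos : 0 < K := by positivity
  refine ⟨min (μ / (4 * L * n)) (min (μ / (2 * a)) (target * a / (2 * n * K))), by positivity, ?_⟩
  intro ke ks hke hks hk W d U' t₀ ht₀ hU hd0 hdd hdtri hWd hW0 hU'
  obtain ⟨hk1, hk2, hk3⟩ : ke / ks < μ / (4 * L * n) ∧ ke / ks < μ / (2 * a) ∧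
      ke / ks < target * a / (2 * n * K) := by
    simpa only [lt_min_iff] using hk
  set κ := ke / ks with hκ
  have hκpos : 0 < κ := by positivity
  have hkeq : ke = ks * κ := by rw [hκ]; field_simp
  rw [lt_div_iff₀ (by positivity)] at hk1 hk2 hk3
  refine eventually_lt_of_deriv_le (A := ks * κ * a / (2 * n)) (B := ks * κ ^ 2 * K) (t₀ := t₀)
    (by positivity) ht₀ hU ?_ ?_
  · intro t ht
    refine (hU' t ht).trans ?_
    set D := edgeSum G (d t) with hD
    have hD0 : 0 ≤ D := edgeSum_nonneg (hd0 t)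
    set s := √(C * D) with hs
    have hs0 : 0 ≤ s := Real.sqrt_nonneg _
    have hs2 : s ^ 2 = C * D := Real.sq_sqrt (by positivity)
    have hds : ∀ i, d t i v₀ ≤ s ^ 2 := fun i => hs2 ▸ hpath (d t) (hd0 t) (hdd t) (hdtri t) i v₀
    have hsum1 : ∑ i, (√(d t i v₀) + d t i v₀) ≤ n * (s + s ^ 2) := by
      have : ∑ i, (√(d t i v₀) + d t i v₀) ≤ ∑ _i : V, (s + s ^ 2) :=
        Finset.sum_le_sum fun i _ => add_le_add
          (Real.sqrt_le_sqrt (hs2 ▸ hds i)) (hds i)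
      simpa [hn, mul_add] using this
    have hsum2 : ∑ i, W i t ≤ n * (2 * (W v₀ t + s ^ 2)) := by
      have : ∑ i, W i t ≤ ∑ _i : V, (2 * (W v₀ t + s ^ 2)) :=
        Finset.sum_le_sum fun i _ => (hWd t i).trans (by have := hds i; linarith)
      simpa [hn] using this
    have hbD : b * D = μ * s ^ 2 := by rw [hs2, hμ]; field_simp
    -- the bracket of the dissipation inequality, in units of `ks`
    have h1 : κ * (a * (W v₀ t + s ^ 2)) - κ ^ 2 * K
        ≤ κ * (a * W v₀ t - L * (n * (s + s ^ 2))) + μ * s ^ 2 := by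
      -- Young's inequality, with the disagreement `s`
      have e1 : κ * L * n * s ≤ κ ^ 2 * K + μ / 4 * s ^ 2 := by
        have : κ ^ 2 * K + μ / 4 * s ^ 2 - κ * L * n * s = (κ * L * n - μ / 2 * s) ^ 2 / μ := by
          rw [hK]; field_simp; ring
        have : 0 ≤ (κ * L * n - μ / 2 * s) ^ 2 / μ := by positivity
        linarith
      have e2 : κ * L * n * s ^ 2 ≤ μ / 4 * s ^ 2 := by
        gcongr; linarith
      have e3 : κ * a * s ^ 2 ≤ μ / 2 * s ^ 2 := by
        gcongr; linarith
      linarith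
    have h2 : κ * a / (2 * n) * ∑ i, W i t ≤ κ * (a * (W v₀ t + s ^ 2)) := by
      calc κ * a / (2 * n) * ∑ i, W i t ≤ κ * a / (2 * n) * (n * (2 * (W v₀ t + s ^ 2))) := by
            gcongr
        _ = _ := by field_simp
    have h3 : κ * (a * W v₀ t - L * (n * (s + s ^ 2)))
        ≤ κ * (a * W v₀ t - L * ∑ i, (√(d t i v₀) + d t i v₀)) := by gcongr
    have h4 : ks * (κ * a / (2 * n) * ∑ i, W i t - κ ^ 2 * K) ≤
        ks * (κ * (a * W v₀ t - L * ∑ i, (√(d t i v₀) + d t i v₀)) + b * D) := by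
      gcongr; linarith
    rw [hkeq]
    have h5 : ks * κ * a / (2 * n) * ∑ i, W i t = ks * (κ * a / (2 * n) * ∑ i, W i t) := by ring
    linarith
  · have : ks * κ ^ 2 * K / (ks * κ * a / (2 * n)) = κ * (2 * n * K) / a := by
      field_simp
    rw [this, div_lt_iff₀ ha]
    exact hk3

open Classical in
/-- Propagation of positivity along a connected graph: in a cooperative system of differential
inequalities with a source at the vertices of `F`, every component exceeds a fixed height `η` after
a fixed time `τ`.  Both depend on the constants of the system only, not on the solution. -/
theorem exists_uniform_lower_bound {G : SimpleGraph V} (hG : G.Connected) {F : Finset V}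
    (hF : F.Nonempty) {A a : ℝ} (hA : 0 < A) (ha : 0 < a) :
    ∃ η : ℝ, 0 < η ∧ ∃ τ : ℝ, 0 ≤ τ ∧ ∀ (d d' : V → ℝ → ℝ) (t₀ : ℝ), 0 ≤ t₀ →
      (∀ i t, t₀ ≤ t → 0 ≤ d i t) →
      (∀ i t, t₀ ≤ t → HasDerivWithinAt (d i) (d' i t) (Set.Ici 0) t) →
      (∀ i t, t₀ ≤ t → -A * d i t + a * (if i ∈ F then 1 else 0) +
        a * ∑ j ∈ Finset.univ.filter (fun j => G.Adj j i), d j t ≤ d' i t) →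
      ∀ i t, t₀ + τ ≤ t → η ≤ d i t := by
  -- a source term bounded below by `b` lifts `d i` to a definite height within one unit of time
  have lift : ∀ (f f' : ℝ → ℝ) (t₁ b : ℝ), 0 ≤ t₁ → 0 < b → 0 ≤ f t₁ →
      (∀ t, t₁ ≤ t → HasDerivWithinAt f (f' t) (Set.Ici 0) t) →
      (∀ t, t₁ ≤ t → -A * f t + b ≤ f' t) →
      ∀ t, t₁ + 1 ≤ t → b / A * (1 - Real.exp (-A)) ≤ f t := by
    intro f f' t₁ b ht₁ hb hf hd hf' t ht
    have h := le_exp_of_deriv_le (f := fun s => -f s) (f' := fun s => -f' s) (B := -b) hA ht₁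
      (fun s hs => (hd s hs).neg) (fun s hs => by have := hf' s hs; linarith)
      (t := t) (by linarith)
    have h1 : Real.exp (-A * (t - t₁)) ≤ Real.exp (-A) := by
      apply Real.exp_le_exp.2; nlinarith
    have h2 := Real.exp_pos (-A * (t - t₁))
    have h3 : b / A * (1 - Real.exp (-A)) ≤ b / A * (1 - Real.exp (-A * (t - t₁))) := by gcongr
    have h4 : 0 ≤ f t₁ * Real.exp (-A * (t - t₁)) := by positivity
    have h5 : -b / A = -(b / A) := by ring
    rw [h5] at h
    linarith
  have hexp : 0 < 1 - Real.exp (-A) := by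
    have : Real.exp (-A) < 1 := by rw [← Real.exp_zero]; exact Real.exp_lt_exp.2 (by linarith)
    linarith
  have key : ∀ i, ∃ η : ℝ, 0 < η ∧ ∃ τ : ℝ, 0 ≤ τ ∧ ∀ (d d' : V → ℝ → ℝ) (t₀ : ℝ), 0 ≤ t₀ →
      (∀ i t, t₀ ≤ t → 0 ≤ d i t) →
      (∀ i t, t₀ ≤ t → HasDerivWithinAt (d i) (d' i t) (Set.Ici 0) t) →
      (∀ i t, t₀ ≤ t → -A * d i t + a * (if i ∈ F then 1 else 0) +
        a * ∑ j ∈ Finset.univ.filter (fun j => G.Adj j i), d j t ≤ d' i t) →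
      ∀ t, t₀ + τ ≤ t → η ≤ d i t := by
    intro i
    obtain ⟨v, hv⟩ := hF
    obtain ⟨p⟩ := hG.preconnected i v
    induction p with
    | nil =>
      rename_i v
      refine ⟨a / A * (1 - Real.exp (-A)), by positivity, 1, zero_le_one, ?_⟩
      intro d d' t₀ ht₀ hd0 hd hd' t ht
      refine lift (d v) (d' v) t₀ a ht₀ ha (hd0 v t₀ le_rfl) (hd v) (fun s hs => ?_) t ht
      have h1 := hd' v s hs
      have h2 : 0 ≤ ∑ j ∈ Finset.univ.filter (fun j => G.Adj j v), d j s :=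
        Finset.sum_nonneg fun j _ => hd0 j s hs
      rw [if_pos hv] at h1
      nlinarith
    | cons h p ih =>
      rename_i u v w
      obtain ⟨η, hη, τ, hτ, H⟩ := ih hv
      refine ⟨a * η / A * (1 - Real.exp (-A)), by positivity, τ + 1, by positivity, ?_⟩
      intro d d' t₀ ht₀ hd0 hd hd' t ht
      refine lift (d u) (d' u) (t₀ + τ) (a * η) (by positivity) (by positivity)
        (hd0 u _ (by linarith)) (fun s hs => hd u s (by linarith)) (fun s hs => ?_) t
        (by linarith)
      have h1 := hd' u s (by linarith)
      have h2 : η ≤ ∑ j ∈ Finset.univ.filter (fun j => G.Adj j u), d j s :=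
        (H d d' t₀ ht₀ hd0 hd hd' s hs).trans
          (Finset.single_le_sum (f := fun j => d j s) (fun j _ => hd0 j s (by linarith))
            (by simpa using h.symm))
      have h3 : 0 ≤ a * (if u ∈ F then (1 : ℝ) else 0) := by split_ifs <;> simp [ha.le]
      have h4 := mul_le_mul_of_nonneg_left h2 ha.le
      linarith
  choose η hη τ hτ H using key
  obtain ⟨v, hv⟩ := hF
  obtain ⟨i₀, -, hi₀⟩ := Finset.exists_min_image Finset.univ η ⟨v, Finset.mem_univ v⟩
  refine ⟨η i₀, hη i₀, ∑ i, τ i, Finset.sum_nonneg fun i _ => hτ i, ?_⟩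
  intro d d' t₀ ht₀ hd0 hd hd' i t ht
  have : τ i ≤ ∑ i, τ i := Finset.single_le_sum (fun i _ => hτ i) (Finset.mem_univ i)
  exact (hi₀ i (Finset.mem_univ i)).trans (H i d d' t₀ ht₀ hd0 hd hd' t (by linarith))

end Graph

/-! ### Rotations, their traces and unit quaternions -/

namespace SO3

/-- The trace of a rotation. -/
noncomputable def tr (R : SO3) : ℝ := (R : Matrix (Fin 3) (Fin 3) ℝ).trace

theorem coe_mul (R S : SO3) : ((R * S : SO3) : Matrix (Fin 3) (Fin 3) ℝ) = R.1 * S.1 := rfl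

theorem coe_inv (R : SO3) : ((R⁻¹ : SO3) : Matrix (Fin 3) (Fin 3) ℝ) = R.1ᵀ :=
  Matrix.conjTranspose_eq_transpose_of_trivial R.1

theorem mul_transpose (R : SO3) : R.1 * R.1ᵀ = 1 := by
  rw [← coe_inv, ← coe_mul, mul_inv_cancel]; rfl

theorem transpose_mul (R : SO3) : R.1ᵀ * R.1 = 1 := by
  rw [← coe_inv, ← coe_mul, inv_mul_cancel]; rfl

theorem adjugate_eq (R : SO3) : R.1.adjugate = R.1ᵀ := by
  have h : R.1.det = 1 := R.2.2
  have h1 := Matrix.adjugate_mul R.1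
  rw [h, one_smul] at h1
  calc R.1.adjugate = R.1.adjugate * (R.1 * R.1ᵀ) := by rw [mul_transpose, mul_one]
    _ = R.1ᵀ := by rw [← mul_assoc, h1, one_mul]

theorem tr_inv (R : SO3) : tr R⁻¹ = tr R := by
  rw [tr, coe_inv, Matrix.trace_transpose, tr]

theorem tr_mul_comm (R S : SO3) : tr (R * S) = tr (S * R) := by
  rw [tr, coe_mul, Matrix.trace_mul_comm, tr, coe_mul]

theorem phi_eq_sum (R : SO3) :
    phi R = (1 / 2) * ∑ i, ∑ j, ((1 : Matrix (Fin 3) (Fin 3) ℝ) i j - R.1 i j) ^ 2 := by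
  rw [phi, Matrix.frobenius_norm_def, ← Real.sqrt_eq_rpow, Real.sq_sqrt (by positivity)]
  simp [sq_abs]

theorem phi_eq (R : SO3) : phi R = 3 - tr R := by
  have h := congrArg Matrix.trace (mul_transpose R)
  simp only [Matrix.trace, Matrix.diag, Matrix.mul_apply, Matrix.transpose_apply,
    Fin.sum_univ_three, Matrix.one_apply_eq] at h
  rw [phi_eq_sum, tr, Matrix.trace]
  simp [Fin.sum_univ_three, Matrix.one_apply]
  linear_combination (1 / 2) * h

theorem phi_inv_mul_eq_sum (S R : SO3) :
    phi (S⁻¹ * R) = (1 / 2) * ∑ i, ∑ j, (S.1 i j - R.1 i j) ^ 2 := by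
  have hS := congrArg Matrix.trace (mul_transpose S)
  have hR := congrArg Matrix.trace (mul_transpose R)
  simp only [Matrix.trace, Matrix.diag, Matrix.mul_apply, Matrix.transpose_apply,
    Fin.sum_univ_three, Matrix.one_apply_eq] at hS hR
  rw [phi_eq, tr, coe_mul, coe_inv, Matrix.trace]
  simp only [Matrix.diag, Matrix.mul_apply, Matrix.transpose_apply, Fin.sum_univ_three]
  linear_combination (-1 / 2) * hS + (-1 / 2) * hR

theorem phi_nonneg (R : SO3) : 0 ≤ phi R := by rw [phi_eq_sum]; positivity

theorem phi_inv (R : SO3) : phi R⁻¹ = phi R := by rw [phi_eq, phi_eq, tr_inv]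

theorem phi_mul_comm (R S : SO3) : phi (R * S) = phi (S * R) := by
  rw [phi_eq, phi_eq, tr_mul_comm]

theorem phi_one : phi 1 = 0 := by
  rw [phi_eq_sum]; simp

/-- The rotation matrix of the quaternion with scalar part `s` and vector part `u`. -/
def ofQuat (s : ℝ) (u : Fin 3 → ℝ) : Matrix (Fin 3) (Fin 3) ℝ :=
  !![s ^ 2 + u 0 ^ 2 - u 1 ^ 2 - u 2 ^ 2, 2 * (u 0 * u 1 - s * u 2), 2 * (u 0 * u 2 + s * u 1);
     2 * (u 0 * u 1 + s * u 2), s ^ 2 - u 0 ^ 2 + u 1 ^ 2 - u 2 ^ 2, 2 * (u 1 * u 2 - s * u 0);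
     2 * (u 0 * u 2 - s * u 1), 2 * (u 1 * u 2 + s * u 0), s ^ 2 - u 0 ^ 2 - u 1 ^ 2 + u 2 ^ 2]

/-- The unit quaternion with scalar part `s` and vector part `u` represents the rotation `R`. -/
structure IsQuat (R : SO3) (s : ℝ) (u : Fin 3 → ℝ) : Prop where
  norm_sq : s ^ 2 + u ⬝ᵥ u = 1
  eq : R.1 = ofQuat s u

/-- Rotations by an angle other than `π` come from a quaternion with positive scalar part. -/
theorem exists_isQuat {R : SO3} (h : -1 < tr R) : ∃ s u, 0 < s ∧ IsQuat R s u := by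
  have hadj := adjugate_eq R
  have h1 := mul_transpose R
  have h2 := transpose_mul R
  rw [Matrix.adjugate_fin_three] at hadj
  have hc : ∀ i j, _ := fun i j => congrFun (congrFun hadj i) j
  have hr : ∀ i j, _ := fun i j => congrFun (congrFun h1 i) j
  have hl : ∀ i j, _ := fun i j => congrFun (congrFun h2 i) j
  simp only [Matrix.mul_apply, Matrix.transpose_apply, Fin.sum_univ_three] at hc hr hl
  have c00 := hc 0 0
  have c11 := hc 1 1
  have c22 := hc 2 2
  have c01 := hc 0 1
  have c10 := hc 1 0
  have c02 := hc 0 2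
  have c20 := hc 2 0
  have c12 := hc 1 2
  have c21 := hc 2 1
  have r00 := hr 0 0
  have r11 := hr 1 1
  have r22 := hr 2 2
  have r01 := hr 0 1
  have r02 := hr 0 2
  have r12 := hr 1 2
  have l00 := hl 0 0
  have l11 := hl 1 1
  have l22 := hl 2 2
  have l01 := hl 0 1
  have l02 := hl 0 2
  have l12 := hl 1 2
  clear hc hr hl hadj h1 h2
  simp at c00 c11 c22 c01 c10 c02 c20 c12 c21 r00 r11 r22 r01 r02 r12 l00 l11 l22 l01 l02 l12
  have ht : tr R = R.1 0 0 + R.1 1 1 + R.1 2 2 := by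
    simp [tr, Matrix.trace, Fin.sum_univ_three]
  -- the scalar part `q` is determined by `tr R = 4 q² - 1`, and then the vector part by `R - Rᵀ`
  set q := √(1 + tr R) / 2 with hq
  have hqpos : 0 < q := by
    have : 0 < 1 + tr R := by linarith
    positivity
  have hq2 : 4 * q ^ 2 = 1 + (R.1 0 0 + R.1 1 1 + R.1 2 2) := by
    rw [hq, div_pow, Real.sq_sqrt (by linarith)]; linarith
  have hq0 : 4 * q ^ 2 ≠ 0 := by positivity
  obtain ⟨x, hx⟩ : ∃ x, 4 * q * x = R.1 2 1 - R.1 1 2 :=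
    ⟨(R.1 2 1 - R.1 1 2) / (4 * q), by field_simp⟩
  obtain ⟨y, hy⟩ : ∃ y, 4 * q * y = R.1 0 2 - R.1 2 0 :=
    ⟨(R.1 0 2 - R.1 2 0) / (4 * q), by field_simp⟩
  obtain ⟨z, hz⟩ : ∃ z, 4 * q * z = R.1 1 0 - R.1 0 1 :=
    ⟨(R.1 1 0 - R.1 0 1) / (4 * q), by field_simp⟩
  have hxx : 4 * x ^ 2 = 1 + R.1 0 0 - R.1 1 1 - R.1 2 2 := by
    apply mul_left_cancel₀ hq0
    linear_combination (4 * q * x + R.1 2 1 - R.1 1 2) * hx -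
      (1 + R.1 0 0 - R.1 1 1 - R.1 2 2) * hq2 + r11 + r22 - l00 + 2 * c00
  have hyy : 4 * y ^ 2 = 1 - R.1 0 0 + R.1 1 1 - R.1 2 2 := by
    apply mul_left_cancel₀ hq0
    linear_combination (4 * q * y + R.1 0 2 - R.1 2 0) * hy -
      (1 - R.1 0 0 + R.1 1 1 - R.1 2 2) * hq2 + r00 + r22 - l11 + 2 * c11
  have hzz : 4 * z ^ 2 = 1 - R.1 0 0 - R.1 1 1 + R.1 2 2 := by
    apply mul_left_cancel₀ hq0
    linear_combination (4 * q * z + R.1 1 0 - R.1 0 1) * hz -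
      (1 - R.1 0 0 - R.1 1 1 + R.1 2 2) * hq2 + r00 + r11 - l22 + 2 * c22
  have hxy : 4 * (x * y) = R.1 0 1 + R.1 1 0 := by
    apply mul_left_cancel₀ hq0
    linear_combination 4 * q * y * hx + (R.1 2 1 - R.1 1 2) * hy - (R.1 0 1 + R.1 1 0) * hq2
      + c01 + c10 - r01 - l01
  have hxz : 4 * (x * z) = R.1 0 2 + R.1 2 0 := by
    apply mul_left_cancel₀ hq0
    linear_combination 4 * q * z * hx + (R.1 2 1 - R.1 1 2) * hz - (R.1 0 2 + R.1 2 0) * hq2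
      + c02 + c20 - r02 - l02
  have hyz : 4 * (y * z) = R.1 1 2 + R.1 2 1 := by
    apply mul_left_cancel₀ hq0
    linear_combination 4 * q * z * hy + (R.1 0 2 - R.1 2 0) * hz - (R.1 1 2 + R.1 2 1) * hq2
      + c12 + c21 - r12 - l12
  refine ⟨q, ![x, y, z], hqpos, ?_, ?_⟩
  · simp only [dotProduct, Fin.sum_univ_three, Matrix.cons_val]
    linear_combination (hq2 + hxx + hyy + hzz) / 4
  · ext i j
    fin_cases i <;> fin_cases j <;> simp [ofQuat]
    · linear_combination (-hq2 - hxx + hyy + hzz) / 4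
    · linear_combination (-2 * hxy + 2 * hz) / 4
    · linear_combination (-2 * hxz - 2 * hy) / 4
    · linear_combination (-2 * hxy - 2 * hz) / 4
    · linear_combination (-hq2 + hxx - hyy + hzz) / 4
    · linear_combination (-2 * hyz + 2 * hx) / 4
    · linear_combination (-2 * hxz + 2 * hy) / 4
    · linear_combination (-2 * hyz - 2 * hx) / 4
    · linear_combination (-hq2 + hxx + hyy - hzz) / 4

theorem IsQuat.phi_eq {R : SO3} {s : ℝ} {u : Fin 3 → ℝ} (h : IsQuat R s u) :
    phi R = 4 * (u ⬝ᵥ u) := by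
  have := h.norm_sq
  rw [SO3.phi_eq, tr, h.eq]
  simp [dotProduct, Fin.sum_univ_three, ofQuat, Matrix.trace] at *
  linear_combination (-3) * this

theorem IsQuat.phi_inv_mul {S R : SO3} {s r : ℝ} {u v : Fin 3 → ℝ} (hS : IsQuat S s u)
    (hR : IsQuat R r v) : phi (S⁻¹ * R) = 4 * (1 - (s * r + u ⬝ᵥ v) ^ 2) := by
  have h1 := hS.norm_sq
  have h2 := hR.norm_sq
  rw [SO3.phi_eq, tr, coe_mul, coe_inv, hS.eq, hR.eq]
  simp [dotProduct, Fin.sum_univ_three, ofQuat, Matrix.trace, Matrix.mul_apply] at *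
  linear_combination (r ^ 2 + (v 0 * v 0 + v 1 * v 1 + v 2 * v 2)) * h1 + h2

/-- The pull exerted by the rotation `R` on the rotation `S`: along `S' = S ω̂` with
`ω = sk(S⁻¹ R)^∨`, the error `φ(S)` decreases at the rate `pull S R / 2`. -/
noncomputable def pull (S R : SO3) : ℝ := tr R - tr (S⁻¹ * S⁻¹ * R)

/-- With `u = p ν`, `v = q μ` for unit vectors `ν`, `μ`, this is
`16 s (p² r - s p q ⟨ν, μ⟩) (s r + p q ⟨ν, μ⟩)`. -/
theorem IsQuat.pull_eq {S R : SO3} {s r : ℝ} {u v : Fin 3 → ℝ} (hS : IsQuat S s u)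
    (hR : IsQuat R r v) : pull S R =
      16 * s * ((u ⬝ᵥ u) * r - s * (u ⬝ᵥ v)) * (s * r + u ⬝ᵥ v) := by
  have h1 := hS.norm_sq
  rw [pull, tr, tr, coe_mul, coe_mul, coe_inv, hS.eq, hR.eq]
  simp [dotProduct, Fin.sum_univ_three, ofQuat, Matrix.trace, Matrix.mul_apply] at *
  linear_combination (- (3 * r ^ 2 - (v 0 * v 0 + v 1 * v 1 + v 2 * v 2)) *
    (s ^ 2 + (u 0 * u 0 + u 1 * u 1 + u 2 * u 2) + 1)) * h1

theorem hat_vee_skewPart (R : SO3) : hat (vee (skewPart R)) = skewPart R := by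
  ext i j
  fin_cases i <;> fin_cases j <;> simp [hat, vee, skewPart, coe_inv]
  all_goals ring

/-- The derivative of the trace of `S` in the direction of the feedback `sk(S⁻¹ R)^∨` is half
the pull. -/
theorem trace_mul_hat_vee_skewPart (S R : SO3) :
    (S.1 * hat (vee (skewPart (S⁻¹ * R)))).trace = (1 / 2) * pull S R := by
  have h1 : tr (S * (S⁻¹ * R)⁻¹) = tr (S⁻¹ * S⁻¹ * R) := by
    have h : (S * (S⁻¹ * R)⁻¹)⁻¹ = S⁻¹ * R * S⁻¹ := by group
    rw [← tr_inv, h, tr_mul_comm, mul_assoc]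
  have h2 : S * (S⁻¹ * R) = R := by group
  rw [hat_vee_skewPart, skewPart, Matrix.mul_smul, Matrix.trace_smul, mul_sub, Matrix.trace_sub,
    ← coe_mul, ← coe_mul, h2, pull, ← h1, tr, tr, smul_eq_mul]

end SO3

namespace SO3

/-! ### Bounds on the pull -/

theorem le_of_sq_add_sq_eq_one {p q s r : ℝ} (hr : 0 < r)
    (hsp : s ^ 2 + p ^ 2 = 1) (hrq : r ^ 2 + q ^ 2 = 1) (hq : 0 ≤ q) (hqp : q ≤ p) : s ≤ r := by
  have : q ^ 2 ≤ p ^ 2 := by gcongr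
  exact abs_le_of_sq_le_sq' (by linarith) hr.le |>.2

/-- If `s = cos α`, `p = sin α`, `r = cos γ`, `q = sin γ`, the worst case `y = p q` has left factor
`sin α sin (α - γ)`, which is compared with `sin² α - sin² γ = sin (α - γ) sin (α + γ)`. -/
theorem quatPull_factor_ge {s r p q y : ℝ} (hs : 0 < s) (hr : 0 < r) (hp : 0 ≤ p) (hq : 0 ≤ q)
    (hsp : s ^ 2 + p ^ 2 = 1) (hrq : r ^ 2 + q ^ 2 = 1) (hy : y ≤ p * q) (hqp : q ≤ p) :
    p * (p ^ 2 - q ^ 2) ≤ p ^ 2 * r - s * y := by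
  have hprod : (p * r - s * q) * (p * r + s * q) = p ^ 2 - q ^ 2 := by
    linear_combination p ^ 2 * hrq - q ^ 2 * hsp
  have hF : p * (p * r - s * q) ≤ p ^ 2 * r - s * y := by
    have : s * y ≤ s * (p * q) := by gcongr
    linarith
  have hsr : s ≤ r := le_of_sq_add_sq_eq_one hr hsp hrq hq hqp
  have hD : 0 ≤ p * r - s * q := by
    have : s * q ≤ r * p := by gcongr
    linarith
  have h1 : p * r + s * q ≤ 1 := by linarith [sq_nonneg (p - r), sq_nonneg (s - q)]
  refine le_trans (mul_le_mul_of_nonneg_left ?_ hp) hF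
  rw [← hprod]
  exact mul_le_of_le_one_right hD h1

theorem quatPull_factor_ge_neg {s r p q y : ℝ} (hs : 0 < s) (hp : 0 ≤ p)
    (hsp : s ^ 2 + p ^ 2 = 1) (hrq : r ^ 2 + q ^ 2 = 1) (hy : y ≤ p * q) (hpq : p ≤ q)
    (hsr : 1 ≤ s + r) : -(q ^ 2 - p ^ 2) ≤ p ^ 2 * r - s * y := by
  have hprod : (s * q - p * r) * (p * r + s * q) = q ^ 2 - p ^ 2 := by
    linear_combination q ^ 2 * hsp - p ^ 2 * hrq
  have hF : p * (p * r - s * q) ≤ p ^ 2 * r - s * y := by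
    have : s * y ≤ s * (p * q) := by gcongr
    linarith
  have hrs : r ≤ s := le_of_sq_add_sq_eq_one hs hrq hsp hp hpq
  have hD : 0 ≤ s * q - p * r := by
    have : r * p ≤ s * q := by gcongr
    linarith
  have h1 : p ≤ p * r + s * q := by
    have h2 : s * p ≤ s * q := by gcongr
    have h3 : p * 1 ≤ p * (s + r) := by gcongr
    linarith
  have h4 : (s * q - p * r) * p ≤ (s * q - p * r) * (p * r + s * q) := by gcongr
  linarith

theorem quatPull_nonneg {s r p q y : ℝ} (hs : 0 < s) (hr : 0 < r) (hp : 0 ≤ p) (hq : 0 ≤ q)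
    (hsp : s ^ 2 + p ^ 2 = 1) (hrq : r ^ 2 + q ^ 2 = 1) (hy : |y| ≤ p * q)
    (hqp : q ≤ p) (hp2 : p ^ 2 ≤ 1 / 2) :
    0 ≤ 16 * s * (p ^ 2 * r - s * y) * (s * r + y) := by
  obtain ⟨hy1, hy2⟩ := abs_le.1 hy
  have hsr : s ≤ r := le_of_sq_add_sq_eq_one hr hsp hrq hq hqp
  have hps : p ≤ s := abs_le_of_sq_le_sq' (by linarith) hs.le |>.2
  have h1 : 0 ≤ s * r + y := by
    have : p * q ≤ s * r := by gcongr; linarith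
    linarith
  have h2 : 0 ≤ p ^ 2 * r - s * y := by
    refine le_trans (mul_nonneg hp ?_) (quatPull_factor_ge hs hr hp hq hsp hrq hy2 hqp)
    have : q ^ 2 ≤ p ^ 2 := by gcongr
    linarith
  positivity

theorem quatPull_ge {s r p q y m : ℝ} (hs : 0 < s) (hr : 0 < r) (hp : 0 ≤ p) (hq : 0 ≤ q)
    (hsp : s ^ 2 + p ^ 2 = 1) (hrq : r ^ 2 + q ^ 2 = 1) (hy : |y| ≤ p * q)
    (hm : 1 / 4 ≤ m) (hm' : m < 1 / 2) (hpm : p ^ 2 ≤ m) (hqm : q ^ 2 ≤ m) :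
    (1 - 2 * m) / 2 * (4 * m - 4 * q ^ 2) - 6 * (4 * m - 4 * p ^ 2) ≤
      16 * s * (p ^ 2 * r - s * y) * (s * r + y) := by
  obtain ⟨hy1, hy2⟩ := abs_le.1 hy
  have hs1 : s ≤ 1 := abs_le_of_sq_le_sq' (by linarith [sq_nonneg p]) zero_le_one |>.2
  have hs2 : 2 / 3 ≤ s := abs_le_of_sq_le_sq' (by linarith) hs.le |>.2
  have hr2 : 2 / 3 ≤ r := abs_le_of_sq_le_sq' (by linarith) hr.le |>.2
  have hpq : 2 * (p * q) ≤ p ^ 2 + q ^ 2 := by linarith [sq_nonneg (p - q)]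
  have hE1 : s * r + y ≤ 1 := by linarith [sq_nonneg (s - r)]
  have hE2 : 1 - 2 * m ≤ s * r + y := by
    have : 1 - m ≤ s * r := by
      refine abs_le_of_sq_le_sq' ?_ (by positivity) |>.2
      have : (1 - m) * (1 - m) ≤ s ^ 2 * r ^ 2 := by
        apply mul_le_mul <;> linarith [sq_nonneg s]
      linarith
    linarith
  set E := s * r + y
  have hE0 : 0 ≤ E := by linarith
  have hg : 0 ≤ 1 - 2 * m := by linarith
  rcases le_total q p with hqp | hqp
  · have hF := quatPull_factor_ge hs hr hp hq hsp hrq hy2 hqp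
    have h0 : 0 ≤ p ^ 2 - q ^ 2 := by
      have : q ^ 2 ≤ p ^ 2 := by gcongr
      linarith
    have hF0 : 0 ≤ p ^ 2 * r - s * y := (mul_nonneg hp h0).trans hF
    rcases le_total (1 / 8) (p ^ 2) with h8 | h8
    · have hp3 : 1 / 3 ≤ p := abs_le_of_sq_le_sq' (by linarith) hp |>.2
      have h1 : 1 / 3 * (p ^ 2 - q ^ 2) ≤ p ^ 2 * r - s * y := le_trans (by gcongr) hF
      have h2 : 16 * (2 / 3) * (1 / 3 * (p ^ 2 - q ^ 2)) * (1 - 2 * m) ≤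
          16 * s * (p ^ 2 * r - s * y) * E := by gcongr
      have h3 : 0 ≤ (p ^ 2 - q ^ 2) * (1 - 2 * m) := mul_nonneg h0 hg
      have h4 : (1 - 2 * m) * (m - p ^ 2) ≤ 1 * (m - p ^ 2) := by
        apply mul_le_mul_of_nonneg_right <;> linarith
      linarith
    · have h1 : 0 ≤ 16 * s * (p ^ 2 * r - s * y) * E := by positivity
      have h2 : (1 - 2 * m) * (m - q ^ 2) ≤ 1 * (1 / 2) := by
        apply mul_le_mul <;> linarith [sq_nonneg q]
      linarith
  · have h1 := quatPull_factor_ge_neg hs hp hsp hrq hy2 hqp (by linarith)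
    have h0 : 0 ≤ q ^ 2 - p ^ 2 := by
      have : p ^ 2 ≤ q ^ 2 := by gcongr
      linarith
    have h2 : -(16 * (q ^ 2 - p ^ 2)) ≤ 16 * s * (p ^ 2 * r - s * y) * E := by
      have hE0 : 0 ≤ s * E := by positivity
      have hE3 : s * E ≤ 1 := mul_le_one₀ hs1 (by linarith) hE1
      have e1 : s * E * (-(q ^ 2 - p ^ 2)) ≤ s * E * (p ^ 2 * r - s * y) := by gcongr
      have e2 : s * E * (q ^ 2 - p ^ 2) ≤ 1 * (q ^ 2 - p ^ 2) := by gcongr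
      linarith
    have h3 : (1 - 2 * m) * (m - q ^ 2) ≤ 1 * (m - q ^ 2) := by
      apply mul_le_mul_of_nonneg_right <;> linarith
    linarith

theorem quatPull_add_quatPull_ge {s r p q y : ℝ} (hs : 0 < s) (hr : 0 < r)
    (hsp : s ^ 2 + p ^ 2 = 1) (hrq : r ^ 2 + q ^ 2 = 1) (hy : |y| ≤ p * q)
    (hp2 : p ^ 2 ≤ 1 / 4) (hq2 : q ^ 2 ≤ 1 / 4) :
    4 * (1 - (s * r + y) ^ 2) ≤ 16 * s * (p ^ 2 * r - s * y) * (s * r + y) +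
      16 * r * (q ^ 2 * s - r * y) * (s * r + y) := by
  obtain ⟨hy1, hy2⟩ := abs_le.1 hy
  have hpq : 2 * (p * q) ≤ p ^ 2 + q ^ 2 := by linarith [sq_nonneg (p - q)]
  have hE1 : s * r + y ≤ 1 := by linarith [sq_nonneg (s - r)]
  have hsr : 3 / 4 ≤ s * r := by
    refine abs_le_of_sq_le_sq' ?_ (by positivity) |>.2
    have : (3 / 4 : ℝ) * (3 / 4) ≤ s ^ 2 * r ^ 2 := by
      apply mul_le_mul <;> linarith [sq_nonneg s]
    linarith
  have hE2 : 1 / 2 ≤ s * r + y := by linarith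
  have h1 : 3 * (s - r) ^ 2 ≤ (p - q) ^ 2 := by
    have e1 : (s - r) ^ 2 * (s + r) ^ 2 = (p - q) ^ 2 * (p + q) ^ 2 := by
      have : (s - r) * (s + r) = -((p - q) * (p + q)) := by linear_combination hsp - hrq
      rw [← mul_pow, this, ← mul_pow, neg_sq]
    have e2 : (s - r) ^ 2 * 3 ≤ (s - r) ^ 2 * (s + r) ^ 2 :=
      mul_le_mul_of_nonneg_left (by linarith) (sq_nonneg _)
    have e3 : (p - q) ^ 2 * (p + q) ^ 2 ≤ (p - q) ^ 2 * 1 :=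
      mul_le_mul_of_nonneg_left (by linarith) (sq_nonneg _)
    linarith
  have h2 : 4 * (s - r) ^ 2 ≤ 2 - 2 * (s * r + y) := by linarith
  have h3 : 16 * s * (p ^ 2 * r - s * y) * (s * r + y) + 16 * r * (q ^ 2 * s - r * y) * (s * r + y)
      = 16 * (s * r + y) * ((s ^ 2 + r ^ 2) * (1 - (s * r + y)) - (s - r) ^ 2) := by
    have hp' : p ^ 2 = 1 - s ^ 2 := by linarith
    have hq' : q ^ 2 = 1 - r ^ 2 := by linarith
    rw [hp', hq']; ring
  rw [h3]
  generalize s * r + y = E at *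
  have h4 : 1 - E ≤ (s ^ 2 + r ^ 2) * (1 - E) - (s - r) ^ 2 := by
    have : 3 / 2 * (1 - E) ≤ (s ^ 2 + r ^ 2) * (1 - E) :=
      mul_le_mul_of_nonneg_right (by linarith) (by linarith)
    linarith
  have h5 : 16 * E * (1 - E) ≤ 16 * E * ((s ^ 2 + r ^ 2) * (1 - E) - (s - r) ^ 2) :=
    mul_le_mul_of_nonneg_left h4 (by linarith)
  have h6 : 0 ≤ (3 * E - 1) * (1 - E) := mul_nonneg (by linarith) (by linarith)
  linarith

theorem dotProduct_self_nonneg_fin_three (u : Fin 3 → ℝ) : 0 ≤ u ⬝ᵥ u :=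
  Finset.sum_nonneg fun i _ => mul_self_nonneg (u i)

theorem IsQuat.exists_norm_vec {S R : SO3} {s r : ℝ} {u v : Fin 3 → ℝ} (hS : IsQuat S s u)
    (hR : IsQuat R r v) : ∃ p q : ℝ, 0 ≤ p ∧ 0 ≤ q ∧ p ^ 2 = u ⬝ᵥ u ∧ q ^ 2 = v ⬝ᵥ v ∧
      s ^ 2 + p ^ 2 = 1 ∧ r ^ 2 + q ^ 2 = 1 ∧ |u ⬝ᵥ v| ≤ p * q ∧
      phi S = 4 * p ^ 2 ∧ phi R = 4 * q ^ 2 := by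
  have hu : 0 ≤ u ⬝ᵥ u := dotProduct_self_nonneg_fin_three u
  have hv : 0 ≤ v ⬝ᵥ v := dotProduct_self_nonneg_fin_three v
  have hp := Real.sq_sqrt hu
  have hq := Real.sq_sqrt hv
  refine ⟨√(u ⬝ᵥ u), √(v ⬝ᵥ v), Real.sqrt_nonneg _, Real.sqrt_nonneg _, hp, hq, ?_, ?_, ?_, ?_, ?_⟩
  · rw [hp]; exact hS.norm_sq
  · rw [hq]; exact hR.norm_sq
  · apply abs_le_of_sq_le_sq _ (by positivity)
    rw [mul_pow, hp, hq]
    simp only [dotProduct, Fin.sum_univ_three]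
    linarith [sq_nonneg (u 0 * v 1 - u 1 * v 0), sq_nonneg (u 0 * v 2 - u 2 * v 0),
      sq_nonneg (u 1 * v 2 - u 2 * v 1)]
  · rw [hp, hS.phi_eq]
  · rw [hq, hR.phi_eq]

theorem exists_isQuat_of_phi_lt {R : SO3} (h : phi R < 2) : ∃ s u, 0 < s ∧ IsQuat R s u :=
  exists_isQuat (by rw [SO3.phi_eq] at h; linarith)

/-- Within angle `π / 2`, a rotation pulls those which are farther from the identity towards it. -/
theorem pull_nonneg {S R : SO3} (hS : phi S < 2) (hRS : phi R ≤ phi S) : 0 ≤ pull S R := by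
  obtain ⟨s, u, hs, hSq⟩ := exists_isQuat_of_phi_lt hS
  obtain ⟨r, v, hr, hRq⟩ := exists_isQuat_of_phi_lt (hRS.trans_lt hS)
  obtain ⟨p, q, hp, hq, hpu, hqv, hsp, hrq, hy, h1, h2⟩ := hSq.exists_norm_vec hRq
  rw [hSq.pull_eq hRq, ← hpu]
  exact quatPull_nonneg hs hr hp hq hsp hrq hy (abs_le_of_sq_le_sq' (by linarith) hp |>.2)
    (by linarith)

/-- Within distance `M < 2` from the identity, the pull of `R` is bounded below by the amount
`M - φ(R)` by which `R` lies below the level `M`, as long as `S` itself is close to that level. -/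
theorem pull_ge {S R : SO3} {M : ℝ} (hM : 1 ≤ M) (hM' : M < 2) (hS : phi S ≤ M) (hR : phi R ≤ M) :
    (1 - M / 2) / 2 * (M - phi R) - 6 * (M - phi S) ≤ pull S R := by
  obtain ⟨s, u, hs, hSq⟩ := exists_isQuat_of_phi_lt (hS.trans_lt hM')
  obtain ⟨r, v, hr, hRq⟩ := exists_isQuat_of_phi_lt (hR.trans_lt hM')
  obtain ⟨p, q, hp, hq, hpu, hqv, hsp, hrq, hy, h1, h2⟩ := hSq.exists_norm_vec hRq
  rw [hSq.pull_eq hRq, ← hpu, h1, h2]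
  have := quatPull_ge (m := M / 4) hs hr hp hq hsp hrq hy (by linarith) (by linarith)
    (by linarith) (by linarith)
  linarith

/-- Mutual pulls are dissipative: near the identity, what two rotations gain together dominates
their squared distance. -/
theorem phi_inv_mul_le_pull_add_pull {S R : SO3} (hS : phi S ≤ 1) (hR : phi R ≤ 1) :
    phi (S⁻¹ * R) ≤ pull S R + pull R S := by
  obtain ⟨s, u, hs, hSq⟩ := exists_isQuat_of_phi_lt (hS.trans_lt one_lt_two)
  obtain ⟨r, v, hr, hRq⟩ := exists_isQuat_of_phi_lt (hR.trans_lt one_lt_two)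
  obtain ⟨p, q, hp, hq, hpu, hqv, hsp, hrq, hy, h1, h2⟩ := hSq.exists_norm_vec hRq
  rw [hSq.pull_eq hRq, hRq.pull_eq hSq, hSq.phi_inv_mul hRq, ← hpu, ← hqv, dotProduct_comm v u,
    mul_comm r s]
  exact quatPull_add_quatPull_ge hs hr hsp hrq hy (by linarith) (by linarith)

theorem phi_inv_mul_comm (S R : SO3) : phi (S⁻¹ * R) = phi (R⁻¹ * S) := by
  rw [← phi_inv]; congr 1; group

theorem phi_inv_mul_le (S T R : SO3) :
    phi (S⁻¹ * R) ≤ 2 * (phi (S⁻¹ * T) + phi (T⁻¹ * R)) := by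
  have h : ∑ i, ∑ j, (S.1 i j - R.1 i j) ^ 2 ≤
      ∑ i, ∑ j, (2 * (S.1 i j - T.1 i j) ^ 2 + 2 * (T.1 i j - R.1 i j) ^ 2) :=
    Finset.sum_le_sum fun i _ => Finset.sum_le_sum fun j _ => by
      linarith [sq_nonneg ((S.1 i j - T.1 i j) - (T.1 i j - R.1 i j))]
  simp only [Finset.sum_add_distrib, ← Finset.mul_sum] at h
  simp only [phi_inv_mul_eq_sum]
  linarith

theorem phi_conj (T R : SO3) : phi (T⁻¹ * R * T) = phi R := by
  rw [phi_mul_comm, mul_inv_cancel_left]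

/-- The trace is Lipschitz for the distance `√φ(A⁻¹ B)`. -/
theorem abs_tr_sub_tr_le (A B : SO3) : |tr A - tr B| ≤ √(6 * phi (A⁻¹ * B)) := by
  apply Real.abs_le_sqrt
  rw [phi_inv_mul_eq_sum]
  simp only [tr, Matrix.trace, Matrix.diag, Fin.sum_univ_three]
  linarith [sq_nonneg ((A.1 0 0 - B.1 0 0) - (A.1 1 1 - B.1 1 1)),
    sq_nonneg ((A.1 0 0 - B.1 0 0) - (A.1 2 2 - B.1 2 2)),
    sq_nonneg ((A.1 1 1 - B.1 1 1) - (A.1 2 2 - B.1 2 2)),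
    sq_nonneg (A.1 0 1 - B.1 0 1), sq_nonneg (A.1 0 2 - B.1 0 2), sq_nonneg (A.1 1 0 - B.1 1 0),
    sq_nonneg (A.1 1 2 - B.1 1 2), sq_nonneg (A.1 2 0 - B.1 2 0), sq_nonneg (A.1 2 1 - B.1 2 1)]

theorem abs_pull_sub_pull_le (S S' T : SO3) :
    |pull S T - pull S' T| ≤ 5 * √(phi (S⁻¹ * S')) := by
  -- `S` is replaced by `S'` in one factor at a time; `φ` is invariant under conjugation
  have h1 : phi ((S⁻¹ * S⁻¹ * T)⁻¹ * (S⁻¹ * S'⁻¹ * T)) = phi (S⁻¹ * S') := by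
    have : (S⁻¹ * S⁻¹ * T)⁻¹ * (S⁻¹ * S'⁻¹ * T) = T⁻¹ * (S * S'⁻¹) * T := by group
    rw [this, phi_conj, phi_mul_comm, phi_inv_mul_comm]
  have h2 : phi ((S⁻¹ * S'⁻¹ * T)⁻¹ * (S'⁻¹ * S'⁻¹ * T)) = phi (S⁻¹ * S') := by
    have : (S⁻¹ * S'⁻¹ * T)⁻¹ * (S'⁻¹ * S'⁻¹ * T) =
        (S'⁻¹ * T)⁻¹ * (S * S'⁻¹) * (S'⁻¹ * T) := by group
    rw [this, phi_conj, phi_mul_comm, phi_inv_mul_comm]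
  have h3 := phi_inv_mul_le (S⁻¹ * S⁻¹ * T) (S⁻¹ * S'⁻¹ * T) (S'⁻¹ * S'⁻¹ * T)
  rw [h1, h2] at h3
  have h4 := abs_tr_sub_tr_le (S⁻¹ * S⁻¹ * T) (S'⁻¹ * S'⁻¹ * T)
  have h5 : |pull S T - pull S' T| = |tr (S⁻¹ * S⁻¹ * T) - tr (S'⁻¹ * S'⁻¹ * T)| := by
    rw [abs_sub_comm, pull, pull]; congr 1; ring
  rw [h5]
  refine h4.trans ?_
  rw [show (5 : ℝ) = √(5 ^ 2) by rw [Real.sqrt_sq (by norm_num)], ← Real.sqrt_mul (by norm_num)]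
  apply Real.sqrt_le_sqrt
  linarith [phi_nonneg (S⁻¹ * S')]

/-- Targets near the identity whose rotations sum to a symmetric matrix together pull strictly
towards the identity: the part of the pull which is odd in the vector parts of the targets
cancels. -/
theorem sum_pull_ge {ι : Type*} (F : Finset ι) (P : ι → SO3) (hP : ∀ i ∈ F, phi (P i) ≤ 1 / 2)
    (hsymm : ∀ a b, ∑ i ∈ F, (P i).1 a b = ∑ i ∈ F, (P i).1 b a) {S : SO3} (hS : phi S ≤ 1) :
    9 / 4 * phi S * F.card ≤ ∑ i ∈ F, pull S (P i) := by
  classical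
  obtain ⟨s, u, hs, hSq⟩ := exists_isQuat_of_phi_lt (hS.trans_lt one_lt_two)
  have hex : ∀ i, ∃ rv : ℝ × (Fin 3 → ℝ), i ∈ F → 0 < rv.1 ∧ IsQuat (P i) rv.1 rv.2 := by
    intro i
    by_cases hi : i ∈ F
    · obtain ⟨r, v, hr, h⟩ := exists_isQuat_of_phi_lt ((hP i hi).trans_lt (by norm_num))
      exact ⟨(r, v), fun _ => ⟨hr, h⟩⟩
    · exact ⟨0, fun h => absurd h hi⟩
  choose rv hrv using hex
  have hzero : ∑ i ∈ F, (rv i).1 * (u ⬝ᵥ (rv i).2) = 0 := by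
    have h : ∀ i ∈ F, (rv i).1 * (u ⬝ᵥ (rv i).2) = 1 / 4 * (u 0 * ((P i).1 2 1 - (P i).1 1 2) +
        u 1 * ((P i).1 0 2 - (P i).1 2 0) + u 2 * ((P i).1 1 0 - (P i).1 0 1)) := by
      intro i hi
      rw [(hrv i hi).2.eq]
      simp [ofQuat, dotProduct, Fin.sum_univ_three]
      ring
    rw [Finset.sum_congr rfl h, ← Finset.mul_sum]
    simp only [Finset.sum_add_distrib, ← Finset.mul_sum, Finset.sum_sub_distrib]
    rw [hsymm 2 1, hsymm 0 2, hsymm 1 0]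
    ring
  have hU : 0 ≤ u ⬝ᵥ u := dotProduct_self_nonneg_fin_three u
  have hphi := hSq.phi_eq
  have hs2 : 3 / 4 ≤ s ^ 2 := by have := hSq.norm_sq; linarith
  have hterm : ∀ i ∈ F, 9 / 4 * phi S +
      16 * s * (u ⬝ᵥ u - s ^ 2) * ((rv i).1 * (u ⬝ᵥ (rv i).2)) ≤ pull S (P i) := by
    intro i hi
    obtain ⟨hr, hq⟩ := hrv i hi
    obtain ⟨p, q, hp, hq0, hpu, hqv, hsp, hrq, hy, h1, h2⟩ := hSq.exists_norm_vec hq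
    have hPi := hP i hi
    rw [hSq.pull_eq hq]
    have hy2 : (u ⬝ᵥ (rv i).2) ^ 2 ≤ (u ⬝ᵥ u) * q ^ 2 := by
      rw [← hpu, ← mul_pow]; exact sq_le_sq' (abs_le.1 hy).1 (abs_le.1 hy).2
    have h3 : (3 / 4) * (u ⬝ᵥ u) ≤ (u ⬝ᵥ u) * (rv i).1 ^ 2 - (u ⬝ᵥ (rv i).2) ^ 2 := by
      have : (u ⬝ᵥ u) * (3 / 4) ≤ (u ⬝ᵥ u) * ((rv i).1 ^ 2 - q ^ 2) :=
        mul_le_mul_of_nonneg_left (by linarith) hU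
      linarith
    have h4 : 16 * (3 / 4) * ((3 / 4) * (u ⬝ᵥ u)) ≤
        16 * s ^ 2 * ((u ⬝ᵥ u) * (rv i).1 ^ 2 - (u ⬝ᵥ (rv i).2) ^ 2) := by gcongr
    rw [hphi]
    linarith
  calc 9 / 4 * phi S * F.card
      = ∑ i ∈ F, (9 / 4 * phi S + 16 * s * (u ⬝ᵥ u - s ^ 2) * ((rv i).1 * (u ⬝ᵥ (rv i).2))) := by
        rw [Finset.sum_add_distrib, ← Finset.mul_sum _ _ (16 * s * (u ⬝ᵥ u - s ^ 2)), hzero]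
        simp [mul_comm]
    _ ≤ _ := Finset.sum_le_sum hterm

/-- Positive rotations have angle less than `π / 2`, as seen on a vector orthogonal to the axis. -/
theorem IsPos.phi_lt {R : SO3} (h : R.IsPos) : phi R < 2 := by
  have htr : 0 < tr R := by
    have e : ∀ i : Fin 3, 0 < R.1 i i := fun i => by
      simpa using h (Pi.single i 1) (by simp)
    simpa [tr, Matrix.trace, Fin.sum_univ_three] using add_pos (add_pos (e 0) (e 1)) (e 2)
  obtain ⟨s, u, hs, hR⟩ := exists_isQuat (R := R) (by linarith)
  obtain ⟨x, hx, hxu⟩ : ∃ x : Fin 3 → ℝ, x ≠ 0 ∧ u ⬝ᵥ x = 0 := by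
    by_cases h0 : u 0 = 0 ∧ u 1 = 0
    · exact ⟨Pi.single 0 1, by simp, by simp [h0.1]⟩
    · refine ⟨![-u 1, u 0, 0], fun hx => h0 ⟨?_, ?_⟩, ?_⟩
      · simpa using congrFun hx 1
      · simpa using congrFun hx 0
      · simp [dotProduct, Fin.sum_univ_three]; ring
  have h1 := h x hx
  have h2 : x ⬝ᵥ (R.1 *ᵥ x) = (s ^ 2 - u ⬝ᵥ u) * (x ⬝ᵥ x) + 2 * (u ⬝ᵥ x) ^ 2 := by
    rw [hR.eq]
    simp [ofQuat, dotProduct, Matrix.mulVec, Fin.sum_univ_three]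
    ring
  rw [h2, hxu] at h1
  have h3 : 0 < s ^ 2 - u ⬝ᵥ u := by
    refine pos_of_mul_pos_left ?_ (dotProduct_self_nonneg_fin_three x)
    simpa using h1
  rw [hR.phi_eq]
  linarith [hR.norm_sq]

end SO3

/-! ### The observer in a fixed frame: orientations and positions -/

section Flow

variable {V : Type*} [Fintype V]

open Classical in
/-- The rate of change of `φ(Q i)` under the observer, in a fixed frame centred at the average:
`Q` are the orientation estimates, `P` the orientations of the targets, `F` the viewers. -/
noncomputable def phiRate (G : SimpleGraph V) (F : Finset V) (ke ks : ℝ) (P Q : V → SO3) (i : V) :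
    ℝ :=
  -(1 / 2) * ((if i ∈ F then ke * SO3.pull (Q i) (P i) else 0) +
    ks * ∑ j ∈ Finset.univ.filter (fun j => G.Adj j i), SO3.pull (Q i) (Q j))

/-- The depths `M - φ(Q i)` below a common level `M` satisfy a cooperative system of differential
inequalities, with a source at the viewers. -/
theorem neg_phiRate_ge {G : SimpleGraph V} {F : Finset V} {ke ks M g : ℝ} {P Q : V → SO3}
    (hke : 0 < ke) (hks : 0 < ks) (hM : 1 ≤ M) (hg : 0 < g) (hgM : g ≤ 1 - M / 2)
    (hP : ∀ i ∈ F, phi (P i) ≤ 1 / 2) (hQ : ∀ i, phi (Q i) ≤ M) (i : V) :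
    open Classical in
    -(3 * (ke + ks * Fintype.card V)) * (M - phi (Q i)) +
      min (ke * g / 8) (ks * g / 4) * (if i ∈ F then 1 else 0) +
      min (ke * g / 8) (ks * g / 4) *
        ∑ j ∈ Finset.univ.filter (fun j => G.Adj j i), (M - phi (Q j)) ≤
      -phiRate G F ke ks P Q i := by
  classical
  set a := min (ke * g / 8) (ks * g / 4) with ha
  have hM2 : M < 2 := by linarith
  have ha1 : a ≤ ke * g / 8 := min_le_left _ _
  have ha2 : a ≤ ks * g / 4 := min_le_right _ _
  have hd : ∀ j, 0 ≤ M - phi (Q j) := fun j => sub_nonneg.2 (hQ j)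
  have h1 : -(3 * ke) * (M - phi (Q i)) + a * (if i ∈ F then 1 else 0) ≤
      1 / 2 * (if i ∈ F then ke * SO3.pull (Q i) (P i) else 0) := by
    have h0 : 0 ≤ 3 * ke * (M - phi (Q i)) := mul_nonneg (by positivity) (hd i)
    split_ifs with hi
    · have h := SO3.pull_ge hM hM2 (hQ i) ((hP i hi).trans (by linarith))
      have h2 : g / 2 * (1 / 2) ≤ (1 - M / 2) / 2 * (M - phi (P i)) := by
        have := hP i hi
        apply mul_le_mul <;> linarith
      have h3 : ke * (g / 2 * (1 / 2) - 6 * (M - phi (Q i))) ≤ ke * SO3.pull (Q i) (P i) := by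
        gcongr; linarith
      linarith
    · linarith
  have h2 : -(3 * (ks * Fintype.card V)) * (M - phi (Q i)) +
      a * ∑ j ∈ Finset.univ.filter (fun j => G.Adj j i), (M - phi (Q j)) ≤
      1 / 2 * (ks * ∑ j ∈ Finset.univ.filter (fun j => G.Adj j i), SO3.pull (Q i) (Q j)) := by
    set s := Finset.univ.filter (fun j => G.Adj j i)
    have h3 : ∑ j ∈ s, (a * (M - phi (Q j)) - 3 * ks * (M - phi (Q i))) ≤
        ∑ j ∈ s, 1 / 2 * (ks * SO3.pull (Q i) (Q j)) := by
      refine Finset.sum_le_sum fun j _ => ?_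
      have h := SO3.pull_ge hM hM2 (hQ i) (hQ j)
      have h4 : g / 2 * (M - phi (Q j)) ≤ (1 - M / 2) / 2 * (M - phi (Q j)) := by
        have := hd j
        gcongr
      have h5 : ks * (g / 2 * (M - phi (Q j)) - 6 * (M - phi (Q i))) ≤
          ks * SO3.pull (Q i) (Q j) := by gcongr; linarith
      have h6 : a * (M - phi (Q j)) ≤ ks * g / 4 * (M - phi (Q j)) := by
        have := hd j
        gcongr
      linarith
    rw [Finset.mul_sum s _ ks]
    rw [Finset.sum_sub_distrib, ← Finset.mul_sum, ← Finset.mul_sum, Finset.sum_const,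
      nsmul_eq_mul, ← Finset.mul_sum] at h3
    have hcard : (s.card : ℝ) ≤ Fintype.card V := by exact_mod_cast s.card_le_univ
    have h7 : s.card * (3 * ks * (M - phi (Q i))) ≤
        Fintype.card V * (3 * ks * (M - phi (Q i))) := by
      have := hd i
      gcongr
    linarith
  rw [phiRate]
  linarith

/-- For all positive gains, orientation estimates which start within angle `π / 2` of the average
eventually stay within angle `π / 3` of it. -/
theorem eventually_phi_le_one {G : SimpleGraph V} (hG : G.Connected) {F : Finset V}
    (hF : F.Nonempty) {ke ks : ℝ} (hke : 0 < ke) (hks : 0 < ks) {P : V → SO3} {Q : ℝ → V → SO3}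
    (hP : ∀ i ∈ F, phi (P i) ≤ 1 / 2) (hQ0 : ∀ i, phi (Q 0 i) < 2)
    (hQ : ∀ i t, 0 ≤ t → HasDerivWithinAt (fun s => phi (Q s i))
      (phiRate G F ke ks P (Q t) i) (Set.Ici 0) t) :
    ∃ T, 0 ≤ T ∧ ∀ t, T ≤ t → ∀ i, phi (Q t i) ≤ 1 := by
  classical
  have : Nonempty V := hF.to_type
  obtain ⟨M₀, hM₀, hM₀2, hM₀Q⟩ : ∃ M₀ : ℝ, 1 ≤ M₀ ∧ M₀ < 2 ∧ ∀ i, phi (Q 0 i) ≤ M₀ := by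
    obtain ⟨i₀, hi₀⟩ := Finite.exists_max fun i => phi (Q 0 i)
    exact ⟨max 1 (phi (Q 0 i₀)), le_max_left _ _, max_lt one_lt_two (hQ0 i₀),
      fun i => (hi₀ i).trans (le_max_right _ _)⟩
  have hinv : ∀ t, 0 ≤ t → ∀ i, phi (Q t i) ≤ M₀ := by
    refine forall_le_of_deriv_nonpos_of_max (f := fun i t => phi (Q t i)) hM₀2 hQ ?_ hM₀Q
    intro i t _ hmax hMi hi2
    have h1 : 0 ≤ if i ∈ F then ke * SO3.pull (Q t i) (P i) else 0 := by
      split_ifs with hi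
      · have := SO3.pull_nonneg hi2 (R := P i) (by have := hP i hi; linarith)
        positivity
      · exact le_rfl
    have h2 : 0 ≤ ∑ j ∈ Finset.univ.filter (fun j => G.Adj j i), SO3.pull (Q t i) (Q t j) :=
      Finset.sum_nonneg fun j _ => SO3.pull_nonneg hi2 (hmax j)
    have h3 : 0 ≤ ks * ∑ j ∈ Finset.univ.filter (fun j => G.Adj j i), SO3.pull (Q t i) (Q t j) := by
      positivity
    have h4 : phiRate G F ke ks P (Q t) i = -(1 / 2) *
        ((if i ∈ F then ke * SO3.pull (Q t i) (P i) else 0) + ks *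
        ∑ j ∈ Finset.univ.filter (fun j => G.Adj j i), SO3.pull (Q t i) (Q t j)) := rfl
    rw [h4]
    linarith
  have hg : 0 < 1 - M₀ / 2 := by linarith
  obtain ⟨η, hη, τ, hτ, H⟩ := exists_uniform_lower_bound hG hF
    (A := 3 * (ke + ks * Fintype.card V))
    (a := min (ke * (1 - M₀ / 2) / 8) (ks * (1 - M₀ / 2) / 4)) (by positivity) (by positivity)
  have hstep : ∀ k : ℕ, ∃ T, 0 ≤ T ∧ ∀ t, T ≤ t → ∀ i, phi (Q t i) ≤ max 1 (M₀ - k * η) := by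
    intro k
    induction k with
    | zero => exact ⟨0, le_rfl, fun t ht i => by simpa using Or.inr (hinv t ht i)⟩
    | succ k ih =>
      obtain ⟨T, hT, hTQ⟩ := ih
      set M := max 1 (M₀ - k * η) with hM
      have hM1 : 1 ≤ M := le_max_left _ _
      have hMM₀ : M ≤ M₀ := max_le hM₀ (by have : 0 ≤ k * η := by positivity
                                           linarith)
      -- each period of length `τ` lowers the common level by `η`, until it reaches `1`
      refine ⟨T + τ, by positivity, fun t ht i => ?_⟩
      have h := H (fun i t => M - phi (Q t i)) (fun i t => -phiRate G F ke ks P (Q t) i) T hT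
        (fun i t ht => sub_nonneg.2 (hTQ t ht i))
        (fun i t ht => by simpa using (hQ i t (hT.trans ht)).const_sub M)
        (fun i t ht => by
          convert neg_phiRate_ge (G := G) hke hks hM1 hg (by linarith) hP (hTQ t ht) i) i t ht
      have h' : phi (Q t i) ≤ M - η := by linarith
      refine h'.trans ?_
      rw [hM, ← max_sub_sub_right]
      push_cast
      refine max_le_max (by linarith) (by linarith)
  obtain ⟨k, hk⟩ := exists_nat_gt (1 / η)
  obtain ⟨T, hT, hTQ⟩ := hstep k
  refine ⟨T, hT, fun t ht i => (hTQ t ht i).trans (max_le le_rfl ?_)⟩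
  rw [div_lt_iff₀ hη] at hk
  linarith

/-- The total orientation error is eventually as small as desired if `ke / ks` is small, with a
threshold which does not depend on the initial orientations. -/
theorem exists_gain_sum_phi_lt {G : SimpleGraph V} (hG : G.Connected) {F : Finset V}
    (hF : F.Nonempty) {P : V → SO3} (hP : ∀ i ∈ F, phi (P i) ≤ 1 / 2)
    (hsymm : ∀ a b, ∑ i ∈ F, (P i).1 a b = ∑ i ∈ F, (P i).1 b a) {target : ℝ}
    (htarget : 0 < target) :
    ∃ kbar : ℝ, 0 < kbar ∧ ∀ ke ks : ℝ, 0 < ke → 0 < ks → ke / ks < kbar →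
      ∀ Q : ℝ → V → SO3, (∀ i, phi (Q 0 i) < 2) →
        (∀ i t, 0 ≤ t → HasDerivWithinAt (fun s => phi (Q s i))
          (phiRate G F ke ks P (Q t) i) (Set.Ici 0) t) →
        ∃ T, 0 ≤ T ∧ ∀ t, T ≤ t → ∑ i, phi (Q t i) < target := by
  classical
  obtain ⟨v₀, hv₀⟩ := id hF
  obtain ⟨kbar, hkbar, H⟩ := exists_gain_forall_eventually_lt hG v₀ (a := 9 / 8) (L := 5 / 2)
    (b := 1 / 4) (by norm_num) (by norm_num) (by norm_num) htarget
  refine ⟨kbar, hkbar, fun ke ks hke hks hk Q hQ0 hQ => ?_⟩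
  obtain ⟨T, hT, hT1⟩ := eventually_phi_le_one hG hF hke hks hP hQ0 hQ
  have hsub : ∀ t i j k, phi ((Q t i)⁻¹ * Q t k) ≤
      2 * (phi ((Q t i)⁻¹ * Q t j) + phi ((Q t j)⁻¹ * Q t k)) :=
    fun t i j k => SO3.phi_inv_mul_le _ _ _
  refine H ke ks hke hks hk (fun i t => phi (Q t i)) (fun t i j => phi ((Q t i)⁻¹ * Q t j))
    (fun t => ∑ i, phiRate G F ke ks P (Q t) i) T hT
    (fun t ht => HasDerivWithinAt.fun_sum fun i _ => hQ i t (hT.trans ht))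
    (fun t i j => SO3.phi_nonneg _) (fun t i => by rw [inv_mul_cancel, SO3.phi_one]) hsub
    (fun t i => ?_) (fun t => SO3.phi_nonneg _) (fun t ht => ?_)
  · have := SO3.phi_inv_mul_le 1 (Q t v₀) (Q t i)
    rwa [inv_one, one_mul, one_mul, SO3.phi_inv_mul_comm] at this
  · have hvis : 9 / 4 * phi (Q t v₀) - 5 * ∑ i, √(phi ((Q t i)⁻¹ * Q t v₀)) ≤
        ∑ i ∈ F, SO3.pull (Q t i) (P i) := by
      have h1 := SO3.sum_pull_ge F P hP hsymm (hT1 t ht v₀)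
      have h2 : ∑ i ∈ F, (SO3.pull (Q t v₀) (P i) - 5 * √(phi ((Q t i)⁻¹ * Q t v₀))) ≤
          ∑ i ∈ F, SO3.pull (Q t i) (P i) := Finset.sum_le_sum fun i _ => by
        have := (abs_le.1 (SO3.abs_pull_sub_pull_le (Q t i) (Q t v₀) (P i))).1
        linarith
      rw [Finset.sum_sub_distrib, ← Finset.mul_sum] at h2
      have h3 : ∑ i ∈ F, √(phi ((Q t i)⁻¹ * Q t v₀)) ≤ ∑ i, √(phi ((Q t i)⁻¹ * Q t v₀)) :=
        Finset.sum_le_sum_of_subset_of_nonneg (Finset.subset_univ _)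
          fun i _ _ => Real.sqrt_nonneg _
      have h4 : (1 : ℝ) ≤ F.card := by exact_mod_cast hF.card_pos
      have h5 : 9 / 4 * phi (Q t v₀) * 1 ≤ 9 / 4 * phi (Q t v₀) * F.card := by
        have := SO3.phi_nonneg (Q t v₀)
        gcongr
      linarith
    have hedge : 1 / 2 * edgeSum G (fun i j => phi ((Q t i)⁻¹ * Q t j)) ≤
        edgeSum G (fun i j => SO3.pull (Q t i) (Q t j)) := by
      have h1 := edgeSum_mono (G := G) fun i j =>
        SO3.phi_inv_mul_le_pull_add_pull (hT1 t ht i) (hT1 t ht j)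
      rw [edgeSum_add, edgeSum_swap G (fun i j => SO3.pull (Q t i) (Q t j))] at h1
      linarith
    have hrate : ∑ i, phiRate G F ke ks P (Q t) i = -(1 / 2) *
        (ke * ∑ i ∈ F, SO3.pull (Q t i) (P i) +
          ks * edgeSum G (fun i j => SO3.pull (Q t i) (Q t j))) := by
      simp only [phiRate, edgeSum]
      rw [← Finset.mul_sum, Finset.sum_add_distrib, ← Finset.mul_sum, Finset.mul_sum F,
        Finset.sum_ite_mem, Finset.univ_inter]
    have h6 : 0 ≤ ∑ i, phi ((Q t i)⁻¹ * Q t v₀) := Finset.sum_nonneg fun i _ => SO3.phi_nonneg _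
    rw [hrate, Finset.sum_add_distrib]
    have h7 := mul_le_mul_of_nonneg_left hvis hke.le
    have h8 := mul_le_mul_of_nonneg_left hedge hks.le
    have h9 : 0 ≤ ke * ∑ i, phi ((Q t i)⁻¹ * Q t v₀) := by positivity
    linarith

open scoped RealInnerProductSpace

open Classical in
/-- The velocity of the position estimate `i` under the observer, in a fixed frame centred at the
average: `y` are the position estimates, `b` the positions of the targets, `F` the viewers. -/
noncomputable def posRate {E : Type*} [AddCommGroup E] [Module ℝ E] (G : SimpleGraph V)
    (F : Finset V) (ke ks : ℝ) (b y : V → E) (i : V) : E :=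
  (if i ∈ F then ke • (b i - y i) else 0) +
    ks • ∑ j ∈ Finset.univ.filter (fun j => G.Adj j i), (y j - y i)

/-- The total position error is eventually as small as desired if `ke / ks` is small. -/
theorem exists_gain_sum_norm_sq_lt {E : Type*} [NormedAddCommGroup E] [InnerProductSpace ℝ E]
    {G : SimpleGraph V} (hG : G.Connected) {F : Finset V}
    (hF : F.Nonempty) {b : V → E} (hb : ∑ i ∈ F, b i = 0) {target : ℝ} (htarget : 0 < target) :
    ∃ kbar : ℝ, 0 < kbar ∧ ∀ ke ks : ℝ, 0 < ke → 0 < ks → ke / ks < kbar →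
      ∀ y : ℝ → V → E,
        (∀ i t, 0 ≤ t → HasDerivWithinAt (fun s => ‖y s i‖ ^ 2)
          (2 * ⟪y t i, posRate G F ke ks b (y t) i⟫) (Set.Ici 0) t) →
        ∃ T, 0 ≤ T ∧ ∀ t, T ≤ t → ∑ i, ‖y t i‖ ^ 2 < target := by
  classical
  obtain ⟨v₀, hv₀⟩ := id hF
  set B := ∑ i ∈ F, ‖b i‖ with hB
  have hB0 : 0 ≤ B := Finset.sum_nonneg fun i _ => norm_nonneg _
  obtain ⟨kbar, hkbar, H⟩ := exists_gain_forall_eventually_lt hG v₀ (a := 1) (L := 2 * B + 2)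
    (b := 1) one_pos (by positivity) one_pos htarget
  refine ⟨kbar, hkbar, fun ke ks hke hks hk y hy => ?_⟩
  have hquasi : ∀ x z w : E, ‖x - w‖ ^ 2 ≤ 2 * (‖x - z‖ ^ 2 + ‖z - w‖ ^ 2) := by
    intro x z w
    have h1 : ‖x - w‖ ≤ ‖x - z‖ + ‖z - w‖ := norm_sub_le_norm_sub_add_norm_sub _ _ _
    have h2 : ‖x - w‖ ^ 2 ≤ (‖x - z‖ + ‖z - w‖) ^ 2 := by gcongr
    linarith [sq_nonneg (‖x - z‖ - ‖z - w‖)]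
  refine H ke ks hke hks hk (fun i t => ‖y t i‖ ^ 2) (fun t i j => ‖y t i - y t j‖ ^ 2)
    (fun t => ∑ i, 2 * ⟪y t i, posRate G F ke ks b (y t) i⟫) 0 le_rfl
    (fun t ht => HasDerivWithinAt.fun_sum fun i _ => hy i t ht)
    (fun t i j => by positivity) (fun t i => by simp) (fun t i j k => hquasi _ _ _)
    (fun t i => ?_) (fun t => by positivity) (fun t ht => ?_)
  · have := hquasi (y t i) (y t v₀) 0
    simp only [sub_zero] at this
    linarith
  · have hvis : ∑ i ∈ F, 2 * ⟪y t i, b i - y t i⟫ ≤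
        -(‖y t v₀‖ ^ 2 - (2 * B + 2) * ∑ i, (√(‖y t i - y t v₀‖ ^ 2) + ‖y t i - y t v₀‖ ^ 2)) := by
      have h1 : ∀ i ∈ F, 2 * ⟪y t i, b i - y t i⟫ ≤ 2 * ⟪y t v₀, b i⟫ +
          ((2 * B + 2) * (√(‖y t i - y t v₀‖ ^ 2) + ‖y t i - y t v₀‖ ^ 2) - ‖y t v₀‖ ^ 2) := by
        intro i hi
        have hbi : ‖b i‖ ≤ B := Finset.single_le_sum (fun j _ => norm_nonneg (b j)) hi
        have e1 : ⟪y t i, b i - y t i⟫ = ⟪y t v₀, b i⟫ + ⟪y t i - y t v₀, b i⟫ - ‖y t i‖ ^ 2 := by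
          rw [inner_sub_right, real_inner_self_eq_norm_sq, inner_sub_left]; ring
        have e2 : ⟪y t i - y t v₀, b i⟫ ≤ B * ‖y t i - y t v₀‖ :=
          (real_inner_le_norm _ _).trans (by rw [mul_comm]; gcongr)
        have e3 := hquasi (y t v₀) (y t i) 0
        simp only [sub_zero] at e3
        rw [norm_sub_rev] at e3
        rw [Real.sqrt_sq (norm_nonneg _), e1]
        have e4 : 0 ≤ B * ‖y t i - y t v₀‖ ^ 2 := by positivity
        have e5 := norm_nonneg (y t i - y t v₀)
        linarith
      refine (Finset.sum_le_sum h1).trans ?_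
      rw [Finset.sum_add_distrib, Finset.sum_sub_distrib, ← Finset.mul_sum, ← Finset.mul_sum,
        ← inner_sum, hb, inner_zero_right, Finset.sum_const, nsmul_eq_mul]
      have h3 : ∑ i ∈ F, (√(‖y t i - y t v₀‖ ^ 2) + ‖y t i - y t v₀‖ ^ 2) ≤
          ∑ i, (√(‖y t i - y t v₀‖ ^ 2) + ‖y t i - y t v₀‖ ^ 2) :=
        Finset.sum_le_sum_of_subset_of_nonneg (Finset.subset_univ _) fun i _ _ => by positivity
      have h4 : (1 : ℝ) ≤ F.card := by exact_mod_cast hF.card_pos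
      have h5 : 1 * ‖y t v₀‖ ^ 2 ≤ F.card * ‖y t v₀‖ ^ 2 := by gcongr
      have h6 := mul_le_mul_of_nonneg_left h3 (show 0 ≤ 2 * B + 2 by positivity)
      linarith
    have hedge : edgeSum G (fun i j => 2 * ⟪y t i, y t j - y t i⟫) =
        -edgeSum G (fun i j => ‖y t i - y t j‖ ^ 2) := by
      have h1 : ∀ i j, ‖y t i - y t j‖ ^ 2 + 2 * ⟪y t i, y t j - y t i⟫ + ‖y t i‖ ^ 2
          = ‖y t j‖ ^ 2 := by
        intro i j
        rw [norm_sub_sq_real, inner_sub_right, real_inner_self_eq_norm_sq]; ring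
      have h2 : edgeSum G (fun _ j => ‖y t j‖ ^ 2) = edgeSum G (fun i _ => ‖y t i‖ ^ 2) :=
        edgeSum_swap G (fun i _ => ‖y t i‖ ^ 2)
      have h3 : edgeSum G (fun i j => ‖y t i - y t j‖ ^ 2 + 2 * ⟪y t i, y t j - y t i⟫ +
          ‖y t i‖ ^ 2) = edgeSum G (fun i _ => ‖y t i‖ ^ 2) := by
        simp only [h1, h2]
      rw [edgeSum_add, edgeSum_add] at h3
      linarith
    have hrate : ∑ i, 2 * ⟪y t i, posRate G F ke ks b (y t) i⟫ =
        ke * ∑ i ∈ F, 2 * ⟪y t i, b i - y t i⟫ +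
          ks * edgeSum G (fun i j => 2 * ⟪y t i, y t j - y t i⟫) := by
      have h1 : ∀ i, 2 * ⟪y t i, posRate G F ke ks b (y t) i⟫ =
          (if i ∈ F then ke * (2 * ⟪y t i, b i - y t i⟫) else 0) +
          ks * ∑ j ∈ Finset.univ.filter (fun j => G.Adj j i), 2 * ⟪y t i, y t j - y t i⟫ := by
        intro i
        rw [posRate, inner_add_right, inner_smul_right, inner_sum, ← Finset.mul_sum]
        split_ifs
        · rw [inner_smul_right]; ring
        · rw [inner_zero_right]; ring
      simp only [h1, edgeSum]
      rw [Finset.sum_add_distrib, ← Finset.mul_sum, Finset.mul_sum F, Finset.sum_ite_mem,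
        Finset.univ_inter]
    rw [hrate, hedge]
    have h7 := mul_le_mul_of_nonneg_left hvis hke.le
    linarith

end Flow

/-! ### Derivatives of matrix-valued functions -/

theorem hasDerivWithinAt_matrix {l m : Type*} [Fintype l] [Fintype m] {A : ℝ → Matrix l m ℝ}
    {A' : Matrix l m ℝ} {s : Set ℝ} {t : ℝ} :
    HasDerivWithinAt A A' s t ↔ ∀ i j, HasDerivWithinAt (fun x => A x i j) (A' i j) s t := by
  refine (hasDerivWithinAt_pi (φ := (A : ℝ → l → m → ℝ)) (φ' := A')).trans ?_
  exact forall_congr' fun i => hasDerivWithinAt_pi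

theorem HasDerivWithinAt.matrix_mul {l m n : Type*} [Fintype l] [Fintype m] [Fintype n]
    {A : ℝ → Matrix l m ℝ} {B : ℝ → Matrix m n ℝ} {A' : Matrix l m ℝ} {B' : Matrix m n ℝ}
    {s : Set ℝ} {t : ℝ} (hA : HasDerivWithinAt A A' s t) (hB : HasDerivWithinAt B B' s t) :
    HasDerivWithinAt (fun x => A x * B x) (A' * B t + A t * B') s t := by
  rw [hasDerivWithinAt_matrix] at *
  intro i j
  simp only [Matrix.mul_apply, Matrix.add_apply, ← Finset.sum_add_distrib]
  exact HasDerivWithinAt.fun_sum fun k _ => (hA i k).mul (hB k j)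

/-! ### Rigid motions acting on points -/

namespace SO3

theorem act_add (R : SO3) (x y : EuclideanSpace ℝ (Fin 3)) : act R (x + y) = act R x + act R y := by
  simp [act, Matrix.mulVec_add]

theorem act_neg (R : SO3) (x : EuclideanSpace ℝ (Fin 3)) : act R (-x) = -act R x := by
  simp [act, Matrix.mulVec_neg]

theorem act_mul (R S : SO3) (x : EuclideanSpace ℝ (Fin 3)) :
    act (R * S) x = act R (act S x) := by
  simp [act, Matrix.mulVec_mulVec]

theorem act_one (x : EuclideanSpace ℝ (Fin 3)) : act 1 x = x := by
  simp [act]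

theorem norm_act (R : SO3) (x : EuclideanSpace ℝ (Fin 3)) : ‖act R x‖ = ‖x‖ := by
  have h : ∀ y : EuclideanSpace ℝ (Fin 3), ‖y‖ ^ 2 = y.ofLp ⬝ᵥ y.ofLp := fun y => by
    rw [EuclideanSpace.real_norm_sq_eq, dotProduct]
    simp [sq]
  rw [← sq_eq_sq₀ (norm_nonneg _) (norm_nonneg _), h, h, act, Matrix.dotProduct_mulVec,
    Matrix.vecMul_mulVec, transpose_mul, Matrix.vecMul_one]

theorem eq_of_phi_inv_mul_eq_zero {S R : SO3} (h : phi (S⁻¹ * R) = 0) : S = R := by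
  rw [phi_inv_mul_eq_sum, mul_eq_zero, or_iff_right (by norm_num),
    Finset.sum_eq_zero_iff_of_nonneg fun i _ => by positivity] at h
  ext i j
  have h1 := h i (Finset.mem_univ i)
  rw [Finset.sum_eq_zero_iff_of_nonneg fun i _ => by positivity] at h1
  simpa [sub_eq_zero] using h1 j (Finset.mem_univ j)

theorem trace_mul_hat (R : SO3) (w : Fin 3 → ℝ) :
    (R.1 * hat w).trace = -2 * (w ⬝ᵥ vee (skewPart R)) := by
  simp [Matrix.trace, Fin.sum_univ_three, Matrix.mul_apply, dotProduct, hat, vee, skewPart, coe_inv]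
  ring

theorem vee_skewPart_dotProduct (S R : SO3) :
    vee (skewPart (S⁻¹ * R)) ⬝ᵥ vee (skewPart S) = -(1 / 4) * pull S R := by
  have h1 := trace_mul_hat S (vee (skewPart (S⁻¹ * R)))
  rw [trace_mul_hat_vee_skewPart] at h1
  linarith

end SO3

namespace SE3

theorem rot_mul (g h : SE3) : (g * h).rot = g.rot * h.rot := rfl

theorem rot_inv (g : SE3) : (g⁻¹).rot = g.rot⁻¹ := rfl

theorem pos_inv_mul (g h : SE3) : (g⁻¹ * h).pos = SO3.act g.rot⁻¹ (h.pos - g.pos) := by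
  rw [sub_eq_neg_add, SO3.act_add, SO3.act_neg]; rfl

theorem act_pos_inv_mul (g h : SE3) : SO3.act g.rot (g⁻¹ * h).pos = h.pos - g.pos := by
  rw [pos_inv_mul, ← SO3.act_mul, mul_inv_cancel, SO3.act_one]

theorem norm_pos_inv_mul (g h : SE3) : ‖(g⁻¹ * h).pos‖ = ‖h.pos - g.pos‖ := by
  rw [pos_inv_mul, SO3.norm_act]

theorem psi_eq (g : SE3) : psi g = phi g.rot + 1 / 2 * ‖g.pos‖ ^ 2 := by
  rw [psi, Matrix.frobenius_norm_def, ← Real.sqrt_eq_rpow, Real.sq_sqrt (by positivity),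
    SO3.phi_eq_sum, EuclideanSpace.real_norm_sq_eq]
  simp [Fintype.sum_sum_type, toMatrix, Finset.sum_add_distrib, Matrix.one_apply, mul_add]

theorem toMatrix_mul_wedge_rot (g : SE3) (V : Twist) (a b : Fin 3) :
    (g.toMatrix * V.wedge) (Sum.inl a) (Sum.inl b) = (g.rot.1 * hat V.2) a b := by
  rw [toMatrix, Twist.wedge, Matrix.fromBlocks_multiply]
  simp

theorem toMatrix_mul_wedge_pos (g : SE3) (V : Twist) (a : Fin 3) :
    (g.toMatrix * V.wedge) (Sum.inl a) (Sum.inr ()) = (g.rot.1 *ᵥ V.1) a := by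
  rw [toMatrix, Twist.wedge, Matrix.fromBlocks_multiply]
  simp [Matrix.mul_apply, Matrix.mulVec, dotProduct]

end SE3

/-! ### The centred observer and the optimality conditions -/

section Normalised

variable {V : Type*} [Fintype V]

open Classical in
/-- The observer input in terms of poses `Y` and targets `T` relative to one common frame. -/
noncomputable def feedback (G : SimpleGraph V) (F : Finset V) (ke ks : ℝ) (T Y : V → SE3) (i : V) :
    Twist :=
  (if i ∈ F then ke • errorVec ((Y i)⁻¹ * T i) else 0) +
    ks • ∑ j ∈ Finset.univ.filter (fun j => G.Adj j i), errorVec ((Y i)⁻¹ * Y j)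

theorem mulVec_feedback (G : SimpleGraph V) (F : Finset V) (ke ks : ℝ) (T Y : V → SE3) (i : V) :
    (Y i).rot.1 *ᵥ (feedback G F ke ks T Y i).1 =
      (posRate G F ke ks (fun j => (T j).pos) (fun j => (Y j).pos) i).ofLp := by
  have h : ∀ g : SE3, (Y i).rot.1 *ᵥ (errorVec ((Y i)⁻¹ * g)).1 = (g.pos - (Y i).pos).ofLp :=
    fun g => by rw [← SE3.act_pos_inv_mul]; rfl
  rw [feedback, posRate, Prod.fst_add, Prod.smul_fst, Prod.fst_sum, Matrix.mulVec_add,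
    Matrix.mulVec_smul, Matrix.mulVec_sum]
  simp only [h]
  split_ifs
  · rw [Prod.smul_fst, Matrix.mulVec_smul, h]
    simp [WithLp.ofLp_sum]
  · simp [WithLp.ofLp_sum]

theorem trace_mul_hat_feedback (G : SimpleGraph V) (F : Finset V) (ke ks : ℝ) (T Y : V → SE3)
    (i : V) : (((Y i).rot.1 * hat (feedback G F ke ks T Y i).2)).trace =
      -phiRate G F ke ks (fun j => (T j).rot) (fun j => (Y j).rot) i := by
  have h : ∀ g : SE3, (errorVec ((Y i)⁻¹ * g)).2 ⬝ᵥ vee (skewPart (Y i).rot) =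
      -(1 / 4) * SO3.pull (Y i).rot g.rot := fun g => SO3.vee_skewPart_dotProduct _ _
  rw [SO3.trace_mul_hat, feedback, phiRate, Prod.snd_add, Prod.smul_snd, Prod.snd_sum,
    add_dotProduct, smul_dotProduct, sum_dotProduct]
  simp only [h, ← Finset.mul_sum]
  split_ifs
  · rw [Prod.smul_snd, smul_dotProduct, h]
    simp only [smul_eq_mul]
    ring
  · simp only [Prod.snd_zero, zero_dotProduct, smul_eq_mul]
    ring

variable {G : SimpleGraph V} {F : Finset V} {ke ks : ℝ} {T : V → SE3} {Y : ℝ → V → SE3} {i : V}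
  {t : ℝ}

theorem hasDerivWithinAt_phi
    (h : HasDerivWithinAt (fun s => (Y s i).toMatrix)
      ((Y t i).toMatrix * (feedback G F ke ks T (Y t) i).wedge) (Set.Ici 0) t) :
    HasDerivWithinAt (fun s => phi (Y s i).rot)
      (phiRate G F ke ks (fun j => (T j).rot) (fun j => (Y t j).rot) i) (Set.Ici 0) t := by
  rw [hasDerivWithinAt_matrix] at h
  have h1 : HasDerivWithinAt (fun s => ∑ a, (Y s i).rot.1 a a)
      (∑ a, ((Y t i).rot.1 * hat (feedback G F ke ks T (Y t) i).2) a a) (Set.Ici 0) t :=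
    HasDerivWithinAt.fun_sum fun a _ => by
      have := h (Sum.inl a) (Sum.inl a)
      rw [SE3.toMatrix_mul_wedge_rot] at this
      exact this
  have h2 := trace_mul_hat_feedback G F ke ks T (Y t) i
  rw [Matrix.trace] at h2
  simp only [Matrix.diag] at h2
  rw [h2] at h1
  have h3 := h1.const_sub 3
  rw [neg_neg] at h3
  exact h3.congr (fun s _ => SO3.phi_eq _) (SO3.phi_eq _)

open scoped RealInnerProductSpace in
theorem hasDerivWithinAt_norm_pos_sq
    (h : HasDerivWithinAt (fun s => (Y s i).toMatrix)
      ((Y t i).toMatrix * (feedback G F ke ks T (Y t) i).wedge) (Set.Ici 0) t) :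
    HasDerivWithinAt (fun s => ‖(Y s i).pos‖ ^ 2)
      (2 * ⟪(Y t i).pos, posRate G F ke ks (fun j => (T j).pos) (fun j => (Y t j).pos) i⟫)
      (Set.Ici 0) t := by
  rw [hasDerivWithinAt_matrix] at h
  have h1 : ∀ a, HasDerivWithinAt (fun s => (Y s i).pos a)
      (posRate G F ke ks (fun j => (T j).pos) (fun j => (Y t j).pos) i a) (Set.Ici 0) t := by
    intro a
    have := h (Sum.inl a) (Sum.inr ())
    rw [SE3.toMatrix_mul_wedge_pos, mulVec_feedback] at this
    exact this
  have h2 : HasDerivWithinAt (fun s => ∑ a, (Y s i).pos a ^ 2) (∑ a, 2 * ((Y t i).pos a *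
      posRate G F ke ks (fun j => (T j).pos) (fun j => (Y t j).pos) i a)) (Set.Ici 0) t :=
    HasDerivWithinAt.fun_sum fun a _ => ((h1 a).pow 2).congr_deriv (by norm_num [mul_assoc])
  rw [← Finset.mul_sum] at h2
  simp only [EuclideanSpace.real_norm_sq_eq, PiLp.inner_apply]
  refine HasDerivWithinAt.congr_deriv h2 ?_
  simp [mul_comm]

omit [Fintype V] in
/-- First order optimality in the position: the average is the mean of the target positions. -/
theorem sum_pos_eq_zero
    (h : ∀ k : SE3, ∑ j ∈ F, psi (T j) ≤ ∑ j ∈ F, psi (k⁻¹ * T j)) :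
    ∑ j ∈ F, (T j).pos = 0 := by
  rcases F.eq_empty_or_nonempty with rfl | hF
  · simp
  have hcard : (0 : ℝ) < F.card := by exact_mod_cast hF.card_pos
  set σ := ∑ j ∈ F, (T j).pos with hσ
  -- the minimality is tested on the translation by the mean of the positions
  set m := (F.card : ℝ)⁻¹ • σ with hm
  have h1 := h ⟨m, 1⟩
  have h2 : ∀ j, psi ((⟨m, 1⟩ : SE3)⁻¹ * T j) =
      psi (T j) + 1 / 2 * (‖m‖ ^ 2 - 2 * inner ℝ m (T j).pos) := by
    intro j
    rw [SE3.psi_eq, SE3.psi_eq, SE3.norm_pos_inv_mul, SE3.rot_mul, SE3.rot_inv, inv_one, one_mul,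
      norm_sub_sq_real, real_inner_comm]
    ring
  simp only [h2, Finset.sum_add_distrib, ← Finset.mul_sum, Finset.sum_sub_distrib, ← inner_sum,
    Finset.sum_const, nsmul_eq_mul] at h1
  rw [← hσ, hm, norm_smul, real_inner_smul_left, real_inner_self_eq_norm_sq, norm_inv,
    Real.norm_of_nonneg hcard.le] at h1
  have h3 : (F.card : ℝ) * ((F.card : ℝ)⁻¹ * ‖σ‖) ^ 2 = (F.card : ℝ)⁻¹ * ‖σ‖ ^ 2 := by
    field_simp
  rw [h3] at h1
  have h4 : (F.card : ℝ)⁻¹ * ‖σ‖ ^ 2 ≤ 0 := by linarith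
  have h5 : 0 < (F.card : ℝ)⁻¹ := by positivity
  have h6 : ‖σ‖ ^ 2 ≤ 0 := by
    by_contra hc
    have := mul_pos h5 (not_le.1 hc)
    linarith
  have h7 : ‖σ‖ ^ 2 = 0 := le_antisymm h6 (by positivity)
  simpa using h7

theorem eq_zero_of_forall_mul_le_sq_mul {b K : ℝ} (h : ∀ τ : ℝ, τ * b ≤ τ ^ 2 * K) : b = 0 := by
  have h1 := h (b / (|K| + 1))
  have hK : 0 < |K| + 1 := by positivity
  have h2 : b / (|K| + 1) * b = b ^ 2 * (|K| + 1) / (|K| + 1) ^ 2 := by field_simp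
  have h3 : (b / (|K| + 1)) ^ 2 * K = b ^ 2 * K / (|K| + 1) ^ 2 := by
    rw [div_pow, div_mul_eq_mul_div]
  rw [h2, h3, div_le_div_iff_of_pos_right (by positivity)] at h1
  have h4 : b ^ 2 * K ≤ b ^ 2 * |K| := mul_le_mul_of_nonneg_left (le_abs_self K) (sq_nonneg b)
  have h5 : b ^ 2 = 0 := le_antisymm (by linarith) (sq_nonneg b)
  simpa using h5

theorem SO3.ofQuat_mem {s : ℝ} {u : Fin 3 → ℝ} (h : s ^ 2 + u ⬝ᵥ u = 1) :
    SO3.ofQuat s u ∈ Matrix.specialOrthogonalGroup (Fin 3) ℝ := by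
  simp only [dotProduct, Fin.sum_univ_three] at h
  rw [Matrix.mem_specialOrthogonalGroup_iff, Matrix.mem_orthogonalGroup_iff]
  constructor
  · change SO3.ofQuat s u * (SO3.ofQuat s u)ᵀ = 1
    ext i j
    fin_cases i <;> fin_cases j <;>
      simp [SO3.ofQuat, Matrix.mul_apply, Fin.sum_univ_three]
    · linear_combination (s ^ 2 + (u 0 * u 0 + u 1 * u 1 + u 2 * u 2) + 1) * h
    · ring
    · ring
    · ring
    · linear_combination (s ^ 2 + (u 0 * u 0 + u 1 * u 1 + u 2 * u 2) + 1) * h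
    · ring
    · ring
    · ring
    · linear_combination (s ^ 2 + (u 0 * u 0 + u 1 * u 1 + u 2 * u 2) + 1) * h
  · rw [Matrix.det_fin_three]
    simp [SO3.ofQuat]
    linear_combination ((s ^ 2 + (u 0 * u 0 + u 1 * u 1 + u 2 * u 2)) ^ 2 +
      (s ^ 2 + (u 0 * u 0 + u 1 * u 1 + u 2 * u 2)) + 1) * h

omit [Fintype V] in
/-- First order optimality in the orientation: the rotations relative to the average sum to a
symmetric matrix. -/
theorem sum_rot_symm
    (h : ∀ k : SE3, ∑ j ∈ F, psi (T j) ≤ ∑ j ∈ F, psi (k⁻¹ * T j)) (a b : Fin 3) :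
    ∑ j ∈ F, (T j).rot.1 a b = ∑ j ∈ F, (T j).rot.1 b a := by
  set M : Matrix (Fin 3) (Fin 3) ℝ := fun a b => ∑ j ∈ F, (T j).rot.1 a b with hM
  have hpsi : ∀ (R : SO3) (g : SE3), psi ((⟨0, R⟩ : SE3)⁻¹ * g) =
      psi g + (SO3.tr g.rot - ∑ a, ∑ b, R.1 a b * g.rot.1 a b) := by
    intro R g
    rw [SE3.psi_eq, SE3.psi_eq, SE3.norm_pos_inv_mul, SE3.rot_mul, SE3.rot_inv, sub_zero,
      SO3.phi_eq, SO3.phi_eq, SO3.tr, SO3.coe_mul, SO3.coe_inv, Finset.sum_comm]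
    simp only [Matrix.trace, Matrix.diag, Matrix.mul_apply, Matrix.transpose_apply]
    ring
  have hmax : ∀ R : SO3, ∑ a, ∑ b, R.1 a b * M a b ≤ M 0 0 + M 1 1 + M 2 2 := by
    intro R
    have h1 := h ⟨0, R⟩
    simp only [hpsi, Finset.sum_add_distrib, Finset.sum_sub_distrib] at h1
    have h2 : ∑ j ∈ F, SO3.tr (T j).rot = M 0 0 + M 1 1 + M 2 2 := by
      simp only [SO3.tr, Matrix.trace, Matrix.diag, Fin.sum_univ_three, Finset.sum_add_distrib, hM]
    have h3 : ∑ j ∈ F, ∑ a, ∑ b, R.1 a b * (T j).rot.1 a b = ∑ a, ∑ b, R.1 a b * M a b := by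
      rw [Finset.sum_comm]
      refine Finset.sum_congr rfl fun a _ => ?_
      rw [Finset.sum_comm]
      simp only [hM, Finset.mul_sum]
    linarith
  -- the quaternion `1 + τ w`, where `w` is the axial vector of `M`, tests the minimality
  set w : Fin 3 → ℝ := ![M 2 1 - M 1 2, M 0 2 - M 2 0, M 1 0 - M 0 1] with hw
  have hww : w ⬝ᵥ w = 0 := by
    refine eq_zero_of_forall_mul_le_sq_mul
      (K := (M 0 0 + M 1 1 + M 2 2) * (w ⬝ᵥ w) - w ⬝ᵥ (M *ᵥ w)) fun τ => ?_
    have hN : 0 < 1 + τ ^ 2 * (w ⬝ᵥ w) := by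
      have := SO3.dotProduct_self_nonneg_fin_three w
      positivity
    set N := 1 + τ ^ 2 * (w ⬝ᵥ w) with hNdef
    set ν := (√N)⁻¹ with hν
    have hν2 : ν ^ 2 * N = 1 := by
      rw [hν, inv_pow, Real.sq_sqrt hN.le]; field_simp
    have hunit : ν ^ 2 + ((ν * τ) • w) ⬝ᵥ ((ν * τ) • w) = 1 := by
      rw [smul_dotProduct, dotProduct_smul, smul_eq_mul, smul_eq_mul, ← hν2, hNdef]; ring
    have h1 := hmax ⟨SO3.ofQuat ν ((ν * τ) • w), SO3.ofQuat_mem hunit⟩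
    have h2 : ∑ a, ∑ b, SO3.ofQuat ν ((ν * τ) • w) a b * M a b =
        ν ^ 2 * ((1 - τ ^ 2 * (w ⬝ᵥ w)) * (M 0 0 + M 1 1 + M 2 2) + 2 * τ ^ 2 * (w ⬝ᵥ (M *ᵥ w)) +
          2 * τ * (w ⬝ᵥ w)) := by
      have e : w 0 * w 0 + w 1 * w 1 + w 2 * w 2 =
          w 0 * (M 2 1 - M 1 2) + w 1 * (M 0 2 - M 2 0) + w 2 * (M 1 0 - M 0 1) := by
        simp [hw]
      simp only [SO3.ofQuat, dotProduct, Matrix.mulVec, Fin.sum_univ_three, Pi.smul_apply,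
        smul_eq_mul, Matrix.of_apply, Matrix.cons_val]
      linear_combination (-2 * ν ^ 2 * τ) * e
    simp only at h1
    rw [h2] at h1
    have h3 := mul_le_mul_of_nonneg_left h1 hN.le
    have h4 : ∀ x, N * (ν ^ 2 * x) = x := fun x => by linear_combination x * hν2
    rw [h4, hNdef] at h3
    linarith
  have hw0 : w = 0 := dotProduct_self_eq_zero.1 hww
  have e0 : M 2 1 = M 1 2 := by simpa [hw, sub_eq_zero] using congrFun hw0 0
  have e1 : M 0 2 = M 2 0 := by simpa [hw, sub_eq_zero] using congrFun hw0 1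
  have e2 : M 1 0 = M 0 1 := by simpa [hw, sub_eq_zero] using congrFun hw0 2
  change M a b = M b a
  fin_cases a <;> fin_cases b <;> simp [e0, e1, e2]

end Normalised

/-! ### Centring a visual network at its average -/

namespace VisualNetwork

variable {n : ℕ} (N : VisualNetwork n) (gs : SE3)

/-- The target poses in the frame of the average `gs`. -/
noncomputable def centredTarget (j : Fin n) : SE3 := gs⁻¹ * N.target j

/-- The estimates, carried over to the world frame and then expressed in the frame of the
average `gs`. -/
noncomputable def centredEstimate (gbar : ℝ → Fin n → SE3) (t : ℝ) (i : Fin n) : SE3 :=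
  gs⁻¹ * (N.camPose i t * gbar t i)

theorem rel_inv_mul_rel (t : ℝ) (i : Fin n) (g h : SE3) :
    (N.rel t i g)⁻¹ * N.rel t i h = g⁻¹ * h := by
  simp only [rel]; group

theorem rel_inv_mul (gbar : ℝ → Fin n → SE3) (t : ℝ) (i : Fin n) :
    (N.rel t i gs)⁻¹ * gbar t i = N.centredEstimate gs gbar t i := by
  simp only [rel, centredEstimate]; group

/-- The inputs only involve relative poses, so that the motion of the cameras cancels out of the
observer. -/
theorem observerInput_eq (ke ks : ℝ) (gbar : ℝ → Fin n → SE3) (t : ℝ) (i : Fin n) :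
    N.observerInput ke ks t (gbar t) i =
      feedback N.graph N.viewers ke ks (N.centredTarget gs) (N.centredEstimate gs gbar t) i := by
  have h1 : (gbar t i)⁻¹ * N.rel t i (N.target i) =
      (N.centredEstimate gs gbar t i)⁻¹ * N.centredTarget gs i := by
    simp only [rel, centredEstimate, centredTarget]; group
  have h2 : ∀ j, (gbar t i)⁻¹ * (N.rel t i (N.camPose j t) * gbar t j) =
      (N.centredEstimate gs gbar t i)⁻¹ * N.centredEstimate gs gbar t j := fun j => by
    simp only [rel, centredEstimate]; group
  simp only [observerInput, feedback, h1, h2]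
  congr

theorem hasDerivWithinAt_centredEstimate {ke ks : ℝ} {gbar : ℝ → Fin n → SE3}
    (h : N.IsObserverTrajectory ke ks gbar) (i : Fin n) {t : ℝ} (ht : 0 ≤ t) :
    HasDerivWithinAt (fun s => (N.centredEstimate gs gbar s i).toMatrix)
      ((N.centredEstimate gs gbar t i).toMatrix *
        (feedback N.graph N.viewers ke ks (N.centredTarget gs)
          (N.centredEstimate gs gbar t) i).wedge) (Set.Ici 0) t := by
  have h0 : HasDerivWithinAt (fun _ => (gs⁻¹).toMatrix) 0 (Set.Ici 0) t :=
    hasDerivWithinAt_matrix.2 fun a b => hasDerivWithinAt_const t (Set.Ici 0) _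
  have h1 := h0.matrix_mul ((N.camMotion i t ht).matrix_mul (h i t ht))
  rw [observerInput_eq N gs] at h1
  simp only [centredEstimate, SE3.toMatrix_mul]
  convert h1 using 1
  noncomm_ring

theorem IsAverage.le_psi {N : VisualNetwork n} {gs : SE3} (h : N.IsAverage gs) (k : SE3) :
    ∑ j ∈ N.viewers, psi (N.centredTarget gs j) ≤
      ∑ j ∈ N.viewers, psi (k⁻¹ * N.centredTarget gs j) := by
  have := h (gs * k)
  simpa only [centredTarget, mul_inv_rev, mul_assoc] using this

theorem rhoPos_eq (t : ℝ) : N.rhoPos gs t = ∑ i ∈ N.viewers, ‖(N.centredTarget gs i).pos‖ ^ 2 := by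
  simp only [rhoPos, ← SE3.norm_pos_inv_mul, rel_inv_mul_rel, centredTarget]

theorem targetRotError_eq (t : ℝ) (i : Fin n) :
    N.targetRotError gs t i = (N.centredTarget gs i).rot := by
  rw [centredTarget, ← N.rel_inv_mul_rel t i]; rfl

theorem rhoRot_eq (t : ℝ) : N.rhoRot gs t = ∑ i ∈ N.viewers, phi (N.centredTarget gs i).rot := by
  simp only [rhoRot, targetRotError_eq]

theorem mem_omegaPos_iff {gbar : ℝ → Fin n → SE3} {ε t : ℝ} :
    (fun i => (gbar t i).pos) ∈ N.omegaPos gs ε t ↔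
      1 / (n : ℝ) * ∑ i, ‖(N.centredEstimate gs gbar t i).pos‖ ^ 2 <
        ε * (1 / (N.viewers.card : ℝ) * ∑ i ∈ N.viewers, ‖(N.centredTarget gs i).pos‖ ^ 2) := by
  simp only [omegaPos, Set.mem_ofPred_eq, ← SE3.norm_pos_inv_mul, rel_inv_mul, rhoPos_eq]

theorem mem_omegaRot_iff {gbar : ℝ → Fin n → SE3} {ε t : ℝ} :
    (fun i => (gbar t i).rot) ∈ N.omegaRot gs ε t ↔
      1 / (n : ℝ) * ∑ i, phi (N.centredEstimate gs gbar t i).rot <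
        ε * (1 / (N.viewers.card : ℝ) * ∑ i ∈ N.viewers, phi (N.centredTarget gs i).rot) := by
  simp only [omegaRot, Set.mem_ofPred_eq, ← SE3.rot_inv, ← SE3.rot_mul, rel_inv_mul, rhoRot_eq]

theorem phi_centredTarget_le_phiMax {i : Fin n} (hi : i ∈ N.viewers) (t : ℝ) :
    phi (N.centredTarget gs i).rot ≤ N.phiMax gs t := by
  rw [← N.targetRotError_eq gs t]
  exact le_ciSup (f := fun i : N.viewers => phi (N.targetRotError gs t i))
    (Set.finite_range _).bddAbove ⟨i, hi⟩

theorem phi_centredEstimate_lt {gbar : ℝ → Fin n → SE3}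
    (h : (fun i => (gbar 0 i).rot) ∈ N.admissible gs 0) (i : Fin n) :
    phi (N.centredEstimate gs gbar 0 i).rot < 2 := by
  have h1 := SO3.IsPos.phi_lt (h i)
  rwa [← SE3.rot_inv, ← SE3.rot_mul, ← SO3.phi_inv, ← SE3.rot_inv, mul_inv_rev, inv_inv,
    rel_inv_mul] at h1

theorem TargetAssumption.sum_norm_pos_sq_pos {N : VisualNetwork n} {gs : SE3}
    (h : N.TargetAssumption gs) : 0 < ∑ i ∈ N.viewers, ‖(N.centredTarget gs i).pos‖ ^ 2 := by
  obtain ⟨i, hi, j, hj, hij, -⟩ := h.exists_ne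
  refine lt_of_le_of_ne (Finset.sum_nonneg fun i _ => by positivity) fun h0 => hij ?_
  rw [eq_comm, Finset.sum_eq_zero_iff_of_nonneg fun i _ => by positivity] at h0
  have h1 : ∀ i ∈ N.viewers, (N.target i).pos = gs.pos := fun i hi => by
    have := h0 i hi
    rwa [centredTarget, SE3.norm_pos_inv_mul, sq_eq_zero_iff, norm_eq_zero, sub_eq_zero] at this
  rw [h1 i hi, h1 j hj]

theorem TargetAssumption.sum_phi_rot_pos {N : VisualNetwork n} {gs : SE3}
    (h : N.TargetAssumption gs) : 0 < ∑ i ∈ N.viewers, phi (N.centredTarget gs i).rot := by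
  obtain ⟨i, hi, j, hj, -, hij⟩ := h.exists_ne
  refine lt_of_le_of_ne (Finset.sum_nonneg fun i _ => SO3.phi_nonneg _) fun h0 => hij ?_
  rw [eq_comm, Finset.sum_eq_zero_iff_of_nonneg fun i _ => SO3.phi_nonneg _] at h0
  have h1 : ∀ i ∈ N.viewers, gs.rot = (N.target i).rot := fun i hi =>
    SO3.eq_of_phi_inv_mul_eq_zero (h0 i hi)
  rw [← h1 i hi, ← h1 j hj]

end VisualNetwork

/-! ### Averaging performance -/

theorem theorem1 (n : ℕ) (N : VisualNetwork n) (hconn : N.graph.Connected)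
    (gs : SE3) (havg : N.IsAverage gs) (hassum : N.TargetAssumption gs)
    (ζ β : ℝ) (hζ : ∀ t, 0 ≤ t → N.phiMax gs t < ζ)
    (hβ : β = 1 - Real.sqrt (2 * ζ)) (hβpos : 0 < β)
    (ε : ℝ) (hε : ε ∈ Set.Ioo (0 : ℝ) 1) :
    ∃ kbar : ℝ, 0 < kbar ∧ ∀ ke ks : ℝ, 0 < ke → 0 < ks → ke / ks < kbar →
      ∀ gbar : ℝ → Fin n → SE3, N.IsObserverTrajectory ke ks gbar →
        (fun i => (gbar 0 i).rot) ∈ N.admissible gs 0 →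
        N.PosAveraging gs gbar ε ∧ N.RotAveraging gs gbar (1 - (1 - ε) * β) := by
  obtain ⟨hε0, hε1⟩ := hε
  have hF : N.viewers.Nonempty := Finset.card_pos.1 (by have := hassum.two_le_card; omega)
  have hf : (0 : ℝ) < N.viewers.card := by exact_mod_cast hF.card_pos
  have hn : (0 : ℝ) < n := by
    obtain ⟨i, -⟩ := hF
    exact_mod_cast i.pos
  have hεR : 0 < 1 - (1 - ε) * β := by
    have : β ≤ 1 := by rw [hβ]; linarith [Real.sqrt_nonneg (2 * ζ)]
    have : (1 - ε) * β ≤ (1 - ε) * 1 := mul_le_mul_of_nonneg_left this (by linarith)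
    linarith
  -- `β > 0` bounds `ζ` by `1 / 2`, also when `2 ζ` is negative and its square root is zero
  have hζ2 : 2 * ζ < 1 := by
    have : √(2 * ζ) < 1 := by linarith
    rwa [Real.sqrt_lt' one_pos, one_pow] at this
  have hP : ∀ i ∈ N.viewers, phi (N.centredTarget gs i).rot ≤ 1 / 2 := fun i hi => by
    have h1 := N.phi_centredTarget_le_phiMax gs hi 0
    have h2 := hζ 0 le_rfl
    linarith
  have hρp := hassum.sum_norm_pos_sq_pos
  have hρR := hassum.sum_phi_rot_pos
  obtain ⟨k₁, hk₁, H₁⟩ := exists_gain_sum_norm_sq_lt hconn hF (sum_pos_eq_zero havg.le_psi)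
    (target := n * (ε * (1 / (N.viewers.card : ℝ) *
      ∑ i ∈ N.viewers, ‖(N.centredTarget gs i).pos‖ ^ 2))) (by positivity)
  obtain ⟨k₂, hk₂, H₂⟩ := exists_gain_sum_phi_lt hconn hF hP (sum_rot_symm havg.le_psi)
    (target := n * ((1 - (1 - ε) * β) * (1 / (N.viewers.card : ℝ) *
      ∑ i ∈ N.viewers, phi (N.centredTarget gs i).rot))) (by positivity)
  refine ⟨min k₁ k₂, lt_min hk₁ hk₂, fun ke ks hke hks hk gbar hobs hadm => ⟨?_, ?_⟩⟩
  · obtain ⟨T, hT, h⟩ := H₁ ke ks hke hks (hk.trans_le (min_le_left _ _))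
      (fun t i => (N.centredEstimate gs gbar t i).pos)
      (fun i t ht => hasDerivWithinAt_norm_pos_sq (N.hasDerivWithinAt_centredEstimate gs hobs i ht))
    refine ⟨T, hT, fun t ht => ?_⟩
    rw [VisualNetwork.mem_omegaPos_iff, one_div, inv_mul_lt_iff₀ hn]
    exact h t ht
  · obtain ⟨T, hT, h⟩ := H₂ ke ks hke hks (hk.trans_le (min_le_right _ _))
      (fun t i => (N.centredEstimate gs gbar t i).rot) (N.phi_centredEstimate_lt gs hadm)
      (fun i t ht => hasDerivWithinAt_phi (N.hasDerivWithinAt_centredEstimate gs hobs i ht))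
    refine ⟨T, hT, fun t ht => ?_⟩
    rw [VisualNetwork.mem_omegaRot_iff, one_div, inv_mul_lt_iff₀ hn]
    exact h t ht
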